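/- An involution semigroup is an algebra $(S,\cdot,{}^*)$ of type $(2,1)$ whose multiplication is associative and which satisfies $(xy)^*=y^*x^*$ and $(x^*)^*=x$. For $n,m\ge 1$, define words $\mathbf v_{n,m}^{(h)}$, $h\ge1$, over the variables $x_{i_1i_2\cdots i_h}$ with $i_1,\dots,i_h\in\{1,\dots,2n\}$ by induction on $h$: \[ \mathbf v_{n,m}^{(1)}:=x_1x_2\cdots x_{2n}\,\bigl(x_nx_{n-1}\cdots x_1\cdot x_{n+1}x_{n+2}\cdots x_{2n}\bigr)^{2m-1}, \] and, for $h>1$, \[ \mathbf v_{n,m}^{(h)}:=\mathbf v_{n,m,1}^{(h-1)}\cdots\mathbf v_{n,m,2n}^{(h-1)}\,\bigl(\mathbf v_{n,m,n}^{(h-1)}\cdots\mathbf v_{n,m,1}^{(h-1)}\cdot\mathbf v_{n,m,n+1}^{(h-1)}\cdots\mathbf v_{n,m,2n}^{(h-1)}\bigr)^{2m-1}, \] where $\mathbf v_{n,m,j}^{(h-1)}$ is obtained from $\mathbf v_{n,m}^{(h-1)}$ by replacing each variable $x_{i_1\cdots i_{h-1}}$ by $x_{i_1\cdots i_{h-1}j}$.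 Let $(B_2^1,\cdot,{}^{-1})$ be the $6$-element Brandt monoid, formed by the zero-one matrices \[ \begin{pmatrix}0&0\\0&0\end{pmatrix},\ \begin{pmatrix}1&0\\0&1\end{pmatrix},\ \begin{pmatrix}0&1\\0&0\end{pmatrix},\ \begin{pmatrix}0&0\\1&0\end{pmatrix},\ \begin{pmatrix}1&0\\0&0\end{pmatrix},\ \begin{pmatrix}0&0\\0&1\end{pmatrix} \] under matrix multiplication, with matrix transposition as the involution ${}^{-1}$. Let $\mathcal S=(S,\cdot,{}^*)$ be an involution semigroup for which there exist $q,r\ge1$ such that the semigroup $(S,\cdot)$ satisfies the identities $\mathbf v_{n,q}^{(r)}=(\mathbf v_{n,q}^{(r)})^2$ for all $n\ge2$. If every identity of type $(2,1)$ that holds in $\mathcal S$ also holds in $(B_2^1,\cdot,{}^{-1})$, then the identities of $\mathcal S$ admit no finite basis; that is, there is no finite set $\Sigma$ of identities of $\mathcal S$ such that every identity of $\mathcal S$ holds in all algebras of type $(2,1)$ that satisfy $\Sigma$. -/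

import Mathlib

universe u v

namespace InvSemigroup

/-- Terms of type `(2,1)` (one binary and one unary operation) over the variables `x₀, x₁, x₂, …`. -/
inductive Term : Type
  | var : ℕ → Term
  | mul : Term → Term → Term
  | star : Term → Term

/-- The value of a term in an algebra of type `(2,1)` under an assignment of its variables. -/
def Term.eval {A : Type u} [Mul A] [Star A] (θ : ℕ → A) : Term → A
  | .var i => θ i
  | .mul s t => s.eval θ * t.eval θ
  | .star t => Star.star (t.eval θ)

/-- An identity of type `(2,1)`: a formal equality `lhs = rhs` of two terms. -/
structure Identity : Type where
  lhs : Term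
  rhs : Term

/-- The identity `e` holds in the algebra `A` of type `(2,1)`. -/
def Satisfies (A : Type u) [Mul A] [Star A] (e : Identity) : Prop :=
  ∀ θ : ℕ → A, e.lhs.eval θ = e.rhs.eval θ

/-- `B` is a basis for the identities of `S`: all members of `B` hold in `S`, and every identity
of `S` is a consequence of `B`, that is, holds in every algebra of type `(2,1)` in which all
members of `B` hold. -/
def IsIdentityBasis (S : Type u) [Mul S] [Star S] (B : Set Identity) : Prop :=
  (∀ e ∈ B, Satisfies S e) ∧
    ∀ e : Identity, Satisfies S e →
      ∀ (A : Type v) [Mul A] [Star A], (∀ b ∈ B, Satisfies A b) → Satisfies A e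

/-- The identities of `S` admit a finite basis. -/
def HasFiniteIdentityBasis (S : Type u) [Mul S] [Star S] : Prop :=
  ∃ B : Set Identity, B.Finite ∧ IsIdentityBasis.{u, v} S B

/-- Words over the variables `x_I`, where the index `I = i₁i₂⋯iₕ` is a string of numbers. -/
abbrev Word : Type := FreeMonoid (List ℕ)

/-- `f₁ f₂ ⋯ f₂ₙ (fₙ fₙ₋₁ ⋯ f₁ · fₙ₊₁ fₙ₊₂ ⋯ f₂ₙ) ^ (2m-1)`. -/
def vPattern {M : Type u} [Monoid M] (n m : ℕ) (f : ℕ → M) : M :=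
  ((List.range' 1 (2 * n)).map f).prod *
    (((List.range' 1 n).reverse.map f).prod * ((List.range' (n + 1) n).map f).prod) ^ (2 * m - 1)

/-- The substitution that appends `j` to the index of every variable. -/
def appendIndex (j : ℕ) : Word →* Word :=
  FreeMonoid.map fun I => I ++ [j]

/-- The words `v_{n,m}^{(h)}`, `h ≥ 1`. The recursion starts at the auxiliary value `h = 0`, a single
variable with empty index, so that the word for `h = 1` is the pattern in `x₁, …, x₂ₙ`. -/
def vWord (n m : ℕ) : ℕ → Word
  | 0 => FreeMonoid.of []
  | h + 1 => vPattern n m fun j => appendIndex j (vWord n m h)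

/-- The base case is the word `x₁ ⋯ x₂ₙ (xₙ ⋯ x₁ · xₙ₊₁ ⋯ x₂ₙ) ^ (2m-1)`. -/
theorem vWord_one (n m : ℕ) : vWord n m 1 = vPattern n m fun j => FreeMonoid.of [j] := rfl

/-- The semigroup `S` satisfies the identity `u = w` between semigroup words. Words are evaluated
in `S` with a new identity element adjoined; the value of a nonempty word lies in `S`. -/
def SatisfiesWords (S : Type u) [Semigroup S] (u w : Word) : Prop :=
  ∀ θ : List ℕ → S,
    FreeMonoid.lift (fun I => (θ I : WithOne S)) u =
      FreeMonoid.lift (fun I => (θ I : WithOne S)) w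

/-- The six zero-one matrices that form the Brandt monoid. -/
def brandtSet : Set (Matrix (Fin 2) (Fin 2) ℤ) :=
  {!![0, 0; 0, 0], !![1, 0; 0, 1], !![0, 1; 0, 0], !![0, 0; 1, 0], !![1, 0; 0, 0], !![0, 0; 0, 1]}

theorem brandtSet_mul_mem {a b : Matrix (Fin 2) (Fin 2) ℤ} (ha : a ∈ brandtSet)
    (hb : b ∈ brandtSet) : a * b ∈ brandtSet := by
  simp only [brandtSet, Set.mem_insert_iff, Set.mem_singleton_iff] at ha hb ⊢
  rcases ha with rfl | rfl | rfl | rfl | rfl | rfl <;>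
    rcases hb with rfl | rfl | rfl | rfl | rfl | rfl <;> decide

theorem brandtSet_transpose_mem {a : Matrix (Fin 2) (Fin 2) ℤ} (ha : a ∈ brandtSet) :
    a.transpose ∈ brandtSet := by
  simp only [brandtSet, Set.mem_insert_iff, Set.mem_singleton_iff] at ha ⊢
  rcases ha with rfl | rfl | rfl | rfl | rfl | rfl <;> decide

/-- The 6-element Brandt monoid `B₂¹` under matrix multiplication. -/
def Brandt : Subsemigroup (Matrix (Fin 2) (Fin 2) ℤ) where
  carrier := brandtSet
  mul_mem' := brandtSet_mul_mem

/-- The involution of `B₂¹` (inversion in this inverse semigroup) is matrix transposition. -/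
instance : StarMul Brandt where
  star a := ⟨a.1.transpose, brandtSet_transpose_mem a.2⟩
  star_involutive a := Subtype.ext a.1.transpose_transpose
  star_mul a b := Subtype.ext (Matrix.transpose_mul a.1 b.1)

end InvSemigroup

namespace InvSemigroup

/-! ### The ladder graph and its two-colourings -/

/-! Suppose a finite basis exists, with all variable indices below `k`. It suffices to find an
involution semigroup that satisfies every identity of B₂¹ in these `k` variables but violates v = v²
for some v = v_{n,q}^{(r)}. It is realised as a set `T` of partial injections of a set `V`, closed
under composition and converse, with two points `s`, `t` that no member has together in its domain
(`IsFrame`). If v relates `s` to `t` and v = v², then v leads from `s` to some y and from y to `t`.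
Injectivity gives y = `t`, so `s` and `t` both lie in the domain of v, a contradiction.

Identities pass from B₂¹ to `T` through two-colourings of `V`. If each of `k` given relations
preserves colours or leads from one colour to one colour, then merging points of equal colour maps
each relation into the identity matrix or a matrix unit. Colourings that separate points from each
other and from domains of members therefore reduce statements about values of terms to B₂¹
(`IsFrame.exists_eval`, `IsFrame.eval_imp`).

Frames for higher words come from the ladder graph. Reading v_{n,m}^{(1)} traces the ascending chain
0 → 2n, then repeatedly descends 2n → n by a second chain with the labels n, …, 1 and climbs back to
2n. Each edge is replaced by a copy of the frame for the preceding height, and a relation acts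
simultaneously on all copies with one label. Relations with different labels compose to at most one
pair, so the set stays closed.

The colourings exist because `k` relations use at most `k` labels, so for n ≥ k + 2 some label l ≤ n
is free. A colouring that treats both edges of every label j ≤ n alike must give 0 and 2n the same
colour; dropping the condition at l removes this obstruction. `exists_compatible` extends colourings
of the ladder to the copies, and `IsFrame.spread` completes the induction. -/

/-- The vertices `n = m₀, m₁, …, mₙ = 2n` of the descending chain of the ladder graph; the
ascending chain has the vertices `0, 1, …, 2n`. -/
def mirror (n i : ℕ) : ℕ := if i = 0 then n else if i = n then 2 * n else 2 * n + i

/-- The edges of the ladder graph: `(j, false)` is the edge `j - 1 ⟶ j` for `1 ≤ j ≤ 2n`, and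
`(j, true)` is the edge `mⱼ ⟶ mⱼ₋₁` for `1 ≤ j ≤ n`. Both carry the label `j`. -/
def LadderEdge (n : ℕ) : Type :=
  {p : ℕ × Bool // 1 ≤ p.1 ∧ p.1 ≤ 2 * n ∧ (p.2 = true → p.1 ≤ n)}

namespace LadderEdge

variable {n : ℕ}

def label (e : LadderEdge n) : ℕ := e.1.1

/-- The source (for `false`) and the target (for `true`) of an edge. -/
def vertex (e : LadderEdge n) (p : Bool) : ℕ :=
  if e.1.2 then mirror n (if p then e.1.1 - 1 else e.1.1)
  else if p then e.1.1 else e.1.1 - 1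

theorem label_pos (e : LadderEdge n) : 1 ≤ e.label := e.2.1

theorem label_le (e : LadderEdge n) : e.label ≤ 2 * n := e.2.2.1

/-- The chains share only n = m₀ and 2n = mₙ. At n the ascending labels n and n + 1 meet the
descending label 1; at 2n the ascending label 2n meets the descending label n. Hence edges with
equal labels are disjoint. -/
theorem eq_of_vertex_eq {e e' : LadderEdge n} {p p' : Bool} (hn : 3 ≤ n)
    (hl : e.label = e'.label) (h : e.vertex p = e'.vertex p') : e = e' ∧ p = p' := by
  obtain ⟨⟨j, a⟩, h1, h2, h3⟩ := e
  obtain ⟨⟨j', a'⟩, h1', h2', h3'⟩ := e'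
  simp only [label, vertex, mirror] at *
  subst hl
  cases a <;> cases a' <;> cases p <;> cases p' <;> simp at * <;> grind

theorem vertex_ne (e : LadderEdge n) (hn : 3 ≤ n) : e.vertex false ≠ e.vertex true := fun h =>
  Bool.noConfusion (eq_of_vertex_eq hn rfl h).2

/-- Edges with two given distinct labels meet in at most one way, once it is said with which ends. -/
theorem eq_of_meet {e₁ e₂ e₁' e₂' : LadderEdge n} {p p' : Bool} (hn : 3 ≤ n)
    (hl : e₁.label = e₂.label) (hl' : e₁'.label = e₂'.label) (hne : e₁.label ≠ e₁'.label)
    (h₁ : e₁.vertex p = e₁'.vertex p') (h₂ : e₂.vertex p = e₂'.vertex p') : e₁ = e₂ := by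
  obtain ⟨⟨j, a⟩, h1, h2, h3⟩ := e₁
  obtain ⟨⟨j', a'⟩, h1', h2', h3'⟩ := e₁'
  obtain ⟨⟨i, c⟩, i1, i2, i3⟩ := e₂
  obtain ⟨⟨i', c'⟩, i1', i2', i3'⟩ := e₂'
  simp only [label, vertex, mirror] at *
  subst hl hl'
  suffices a = c by subst this; rfl
  cases a <;> cases c <;> first | rfl | exfalso
  all_goals cases a' <;> cases c' <;> cases p <;> cases p' <;>
    simp only [Bool.false_eq_true, if_true, if_false] at * <;>
    split_ifs at * <;> omega

theorem vertex_eq_zero {e : LadderEdge n} {p : Bool} (hn : 3 ≤ n) (h : e.vertex p = 0) :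
    e.label = 1 ∧ p = false := by
  obtain ⟨⟨j, a⟩, h1, h2, h3⟩ := e
  simp only [label, vertex, mirror] at *
  cases a <;> cases p <;> simp at * <;> grind

theorem vertex_eq_two_mul {e : LadderEdge n} {p : Bool} (hn : 3 ≤ n) (h : e.vertex p = 2 * n) :
    (e.label = n ∧ p = false) ∨ (e.label = 2 * n ∧ p = true) := by
  obtain ⟨⟨j, a⟩, h1, h2, h3⟩ := e
  simp only [label, vertex, mirror] at *
  cases a <;> cases p <;> simp at * <;> grind

/-- An edge has an end that lies on no edge of another given label. -/
theorem exists_vertex_notMem (e : LadderEdge n) (hn : 3 ≤ n) {j : ℕ} (hj : e.label ≠ j) :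
    ∃ p, ∀ e' : LadderEdge n, e'.label = j → ∀ p', e'.vertex p' ≠ e.vertex p := by
  by_contra! hcon
  obtain ⟨e₁, l₁, p₁, h₁⟩ := hcon false
  obtain ⟨e₂, l₂, p₂, h₂⟩ := hcon true
  obtain ⟨⟨i, a⟩, i1, i2, i3⟩ := e
  obtain ⟨⟨j₁, a₁⟩, j1, j2, j3⟩ := e₁
  obtain ⟨⟨j₂, a₂⟩, k1, k2, k3⟩ := e₂
  clear hcon
  simp only [label, vertex, mirror] at *
  subst l₁
  subst l₂
  cases a <;> cases a₁ <;> cases a₂ <;> cases p₁ <;> cases p₂ <;>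
    simp only [Bool.false_eq_true, if_true, if_false] at * <;>
    (try split_ifs at *) <;> omega

end LadderEdge

/-! ### Balanced colourings of the ladder graph -/

/-- The two-colouring `b` of the ladder graph treats the two edges of each label `j ≠ l` alike. -/
def IsBalanced (n l : ℕ) (b : ℕ → Bool) : Prop :=
  ∀ j, 1 ≤ j → j ≤ n → j ≠ l →
    (b (j - 1) = b j ∧ b (mirror n j) = b (mirror n (j - 1))) ∨
      (b (j - 1) = b (mirror n j) ∧ b j = b (mirror n (j - 1)))

/-- All edges with label `j` lead from the colour `a` to the colour `a'`. -/
def HasEnds (n j : ℕ) (b : ℕ → Bool) (a a' : Bool) : Prop :=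
  ∀ e : LadderEdge n, e.label = j → b (e.vertex false) = a ∧ b (e.vertex true) = a'

theorem hasEnds_iff {n j : ℕ} {b : ℕ → Bool} {a a' : Bool} (hj : 1 ≤ j) (hj' : j ≤ 2 * n) :
    HasEnds n j b a a' ↔ (b (j - 1) = a ∧ b j = a') ∧
      (j ≤ n → b (mirror n j) = a ∧ b (mirror n (j - 1)) = a') := by
  constructor
  · intro h
    exact ⟨by simpa [LadderEdge.vertex] using h ⟨(j, false), hj, hj', by simp⟩ rfl,
      fun hn => by simpa [LadderEdge.vertex] using h ⟨(j, true), hj, hj', by simpa⟩ rfl⟩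
  · rintro ⟨h, h'⟩ ⟨⟨i, c⟩, h1, h2, h3⟩ hl
    simp only [LadderEdge.label] at hl
    subst hl
    cases c
    · simpa [LadderEdge.vertex] using h
    · simpa [LadderEdge.vertex] using h' (h3 rfl)

/-- `b` extends the colouring `β` of the ascending chain: the vertex `mᵢ` gets the colour of `i` if
`k₁` holds (for `i < l`) or `k₂` holds (for `l ≤ i`), and the other colour otherwise. -/
structure IsReflection (n l : ℕ) (k₁ k₂ : Prop) (β : ℕ → Prop) (b : ℕ → Bool) : Prop where
  balanced : IsBalanced n l b
  lower : ∀ i, (i ≤ 2 * n ∨ 3 * n ≤ i) → (b i = true ↔ β i)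
  upper : ∀ i, i ≤ n → (b (mirror n i) = true ↔ ((i < l ∧ (β i ↔ k₁)) ∨ (l ≤ i ∧ (β i ↔ k₂))))

/-- Negating the ascending chain gives a balanced colouring whatever `β` is: a monochromatic edge
has a monochromatic mirror image, and reversing a two-coloured edge cancels the negation. Copying
without negation is balanced where `β` is constant. The free label l allows a change from one mode
to the other, and `h₁`, `h₂` make the colours agree at the shared vertices m₀ = n and mₙ = 2n. -/
theorem exists_isReflection {n l : ℕ} (k₁ k₂ : Prop) (β : ℕ → Prop) (hn : 3 ≤ n)
    (hl : 1 ≤ l) (hl' : l ≤ n)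
    (h₁ : (k₁ ∧ ∀ i < l, (β i ↔ β n)) ∨ (¬k₁ ∧ (β n ↔ ¬β 0)))
    (h₂ : (k₂ ∧ ∀ i, l ≤ i → i ≤ n → (β i ↔ β (2 * n))) ∨ (¬k₂ ∧ (β (2 * n) ↔ ¬β n))) :
    ∃ b, IsReflection n l k₁ k₂ β b := by
  classical
  let R (i : ℕ) : Prop := (i < l ∧ (β i ↔ k₁)) ∨ (l ≤ i ∧ (β i ↔ k₂))
  let b (w : ℕ) : Bool := if 2 * n < w ∧ w < 3 * n then decide (R (w - 2 * n)) else decide (β w)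
  have lower : ∀ i, (i ≤ 2 * n ∨ 3 * n ≤ i) → (b i = true ↔ β i) := by
    intro i hi
    simp only [b]
    rw [if_neg (by omega), decide_eq_true_iff]
  have upper : ∀ i, i ≤ n → (b (mirror n i) = true ↔ R i) := by
    intro i hi
    unfold mirror
    split_ifs with h h'
    · subst h
      rw [lower _ (by omega)]
      simp only [R]
      rcases h₁ with ⟨hk, h⟩ | ⟨hk, h⟩
      · have := h 0 (by omega)
        have : ¬l ≤ 0 := by omega
        tauto
      · have : ¬l ≤ 0 := by omega
        have : 0 < l := by omega
        tauto
    · subst h'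
      rw [lower _ (by omega)]
      simp only [R]
      rcases h₂ with ⟨hk, h⟩ | ⟨hk, h⟩
      · have := h i (by omega) le_rfl
        have : ¬i < l := by omega
        tauto
      · have : ¬i < l := by omega
        tauto
    · simp only [b]
      rw [if_pos (by omega), decide_eq_true_iff]
      simp
  refine ⟨b, ?_, lower, upper⟩
  intro j hj hjn hjl
  have key : ∀ x y z w : Bool, ((x = true ↔ y = true) ∧ (z = true ↔ w = true)) ∨
      ((x = true ↔ z = true) ∧ (y = true ↔ w = true)) → (x = y ∧ z = w) ∨ (x = z ∧ y = w) := by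
    decide
  apply key
  rw [upper _ hjn, upper (j - 1) (by omega), lower _ (by omega), lower _ (by omega)]
  simp only [R]
  by_cases hlt : j < l
  · have e1 : j - 1 < l := by omega
    simp only [hlt, e1, not_le.mpr hlt, not_le.mpr e1, true_and, false_and, or_false]
    rcases h₁ with ⟨hk, h⟩ | ⟨hk, h⟩
    · have hj₁ := h j hlt
      have hj₂ := h (j - 1) e1
      exact Or.inl ⟨hj₂.trans hj₁.symm, by rw [hj₁, hj₂]⟩
    · simp only [hk, iff_false]
      by_cases p : β j <;> by_cases p' : β (j - 1) <;> simp [p, p']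
  · have e1 : l ≤ j - 1 := by omega
    simp only [hlt, e1, not_lt.mp hlt, not_lt.mpr e1, true_and, false_and, false_or]
    rcases h₂ with ⟨hk, h⟩ | ⟨hk, h⟩
    · have hj₁ := h j (by omega) hjn
      have hj₂ := h (j - 1) e1 (by omega)
      exact Or.inl ⟨hj₂.trans hj₁.symm, by rw [hj₁, hj₂]⟩
    · simp only [hk, iff_false]
      by_cases p : β j <;> by_cases p' : β (j - 1) <;> simp [p, p']

namespace IsReflection

variable {n l : ℕ} {k₁ k₂ : Prop} {β : ℕ → Prop} {b : ℕ → Bool}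

theorem upper' (h : IsReflection n l k₁ k₂ β b) {w : ℕ} (hw : 2 * n < w) (hw' : w < 3 * n) :
    b w = true ↔ ((w - 2 * n < l ∧ (β (w - 2 * n) ↔ k₁)) ∨ (l ≤ w - 2 * n ∧ (β (w - 2 * n) ↔ k₂))) := by
  rw [← h.upper (w - 2 * n) (by omega), mirror, if_neg (by omega), if_neg (by omega)]
  congr!
  omega

theorem apply (h : IsReflection n l k₁ k₂ β b) {w : ℕ} {c : Bool}
    (h₁ : w ≤ 2 * n ∨ 3 * n ≤ w → (β w ↔ c = true))
    (h₂ : 2 * n < w → w < 3 * n → w - 2 * n < l → ((β (w - 2 * n) ↔ k₁) ↔ c = true))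
    (h₃ : 2 * n < w → w < 3 * n → l ≤ w - 2 * n → ((β (w - 2 * n) ↔ k₂) ↔ c = true)) :
    b w = c := by
  rw [Bool.eq_iff_iff]
  by_cases hw : w ≤ 2 * n ∨ 3 * n ≤ w
  · rw [h.lower w hw, h₁ hw]
  · rw [h.upper' (by omega) (by omega)]
    by_cases hlt : w - 2 * n < l
    · simpa [hlt, not_le.mpr hlt] using h₂ (by omega) (by omega) hlt
    · simpa [hlt, not_lt.mp hlt] using h₃ (by omega) (by omega) (by omega)

theorem hasEnds (h : IsReflection n l k₁ k₂ β b) {j : ℕ} {a a' : Bool} (hj : 1 ≤ j)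
    (hj' : j ≤ 2 * n) (hjl : j ≠ l) (h₁ : β (j - 1) ↔ a = true) (h₂ : β j ↔ a' = true)
    (h₃ : j < l → j ≤ n → ((β j ↔ k₁) ↔ a = true) ∧ ((β (j - 1) ↔ k₁) ↔ a' = true))
    (h₄ : l < j → j ≤ n → ((β j ↔ k₂) ↔ a = true) ∧ ((β (j - 1) ↔ k₂) ↔ a' = true)) :
    HasEnds n j b a a' := by
  rw [hasEnds_iff hj hj']
  refine ⟨⟨by rw [Bool.eq_iff_iff, h.lower _ (by omega), h₁],
    by rw [Bool.eq_iff_iff, h.lower _ (by omega), h₂]⟩, fun hjn => ?_⟩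
  rw [Bool.eq_iff_iff, Bool.eq_iff_iff (b := a'), h.upper _ hjn, h.upper _ (by omega)]
  by_cases hlt : j < l
  · have e1 : j - 1 < l := by omega
    simpa only [hlt, e1, not_le.mpr hlt, not_le.mpr e1, true_and, false_and, or_false] using
      h₃ hlt hjn
  · have e1 : l ≤ j - 1 := by omega
    simpa only [hlt, e1, not_lt.mp hlt, not_lt.mpr e1, true_and, false_and, false_or] using
      h₄ (by omega) hjn

end IsReflection

theorem isBalanced_const (n l : ℕ) (a : Bool) : IsBalanced n l fun _ => a := by
  intro j _ _ _; simp

theorem hasEnds_of_notMem {n j : ℕ} (hj : ¬(1 ≤ j ∧ j ≤ 2 * n)) (b : ℕ → Bool) (a a' : Bool) :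
    HasEnds n j b a a' :=
  fun e he => absurd ⟨e.label_pos, e.label_le⟩ (he ▸ hj)

theorem IsBalanced.not {n l : ℕ} {b : ℕ → Bool} (h : IsBalanced n l b) :
    IsBalanced n l fun i => !b i := by
  intro j h₁ h₂ h₃
  simpa using h j h₁ h₂ h₃

theorem exists_balanced_vertex_true {n l : ℕ} (hn : 3 ≤ n) (hl : 1 ≤ l) (hl' : l ≤ n)
    (w : ℕ) (a a' : Bool) (h₀ : w = 0 → a = true)
    (h₁ : w = 2 * n → a' = true) :
    ∃ b, IsBalanced n l b ∧ b 0 = a ∧ b (2 * n) = a' ∧ b w = true := by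
  cases a <;> cases a' <;> simp at h₀ h₁
  · obtain ⟨b, h⟩ := exists_isReflection (l := l) False False (fun i => i = n ∨ i = w) hn hl hl'
      (by simp; omega) (by simp; omega)
    refine ⟨b, h.balanced, h.apply ?_ ?_ ?_, h.apply ?_ ?_ ?_, h.apply ?_ ?_ ?_⟩ <;> simp <;> omega
  -- Different colours at 0 and 2n require exactly one of the two segments to be negated. The
  -- position of `w` decides which, since the copied segment has to be constant.
  · by_cases hw : w < l ∨ w = n ∨ (2 * n < w ∧ w < 2 * n + l)
    · obtain ⟨b, h⟩ := exists_isReflection (l := l) False True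
        (fun i => l ≤ i ∧ i ≤ n ∨ i = 2 * n ∨ i = w) hn hl hl' (by simp; omega) (by simp; omega)
      refine ⟨b, h.balanced, h.apply ?_ ?_ ?_, h.apply ?_ ?_ ?_, h.apply ?_ ?_ ?_⟩ <;> simp <;> omega
    · obtain ⟨b, h⟩ := exists_isReflection (l := l) True False
        (fun i => i = 2 * n ∨ i = w) hn hl hl' (by simp; omega) (by simp; omega)
      refine ⟨b, h.balanced, h.apply ?_ ?_ ?_, h.apply ?_ ?_ ?_, h.apply ?_ ?_ ?_⟩ <;> simp <;> omega
  · by_cases hw : w < l ∨ (2 * n < w ∧ w < 2 * n + l)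
    · obtain ⟨b, h⟩ := exists_isReflection (l := l) False True
        (fun i => i = 0 ∨ i = w) hn hl hl' (by simp; omega) (by simp; omega)
      refine ⟨b, h.balanced, h.apply ?_ ?_ ?_, h.apply ?_ ?_ ?_, h.apply ?_ ?_ ?_⟩ <;> simp <;> omega
    · obtain ⟨b, h⟩ := exists_isReflection (l := l) True False
        (fun i => i < l ∨ i = n ∨ i = w) hn hl hl' (by simp; omega) (by simp; omega)
      refine ⟨b, h.balanced, h.apply ?_ ?_ ?_, h.apply ?_ ?_ ?_, h.apply ?_ ?_ ?_⟩ <;> simp <;> omega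
  · exact ⟨fun _ => true, isBalanced_const _ _ _, rfl, rfl, rfl⟩

theorem exists_balanced_vertex {n l : ℕ} (hn : 3 ≤ n) (hl : 1 ≤ l) (hl' : l ≤ n)
    (w : ℕ) (a a' c : Bool) (h₀ : w = 0 → c = a)
    (h₁ : w = 2 * n → c = a') :
    ∃ b, IsBalanced n l b ∧ b 0 = a ∧ b (2 * n) = a' ∧ b w = c := by
  cases c
  · obtain ⟨b, hb, h0, h2, h3⟩ := exists_balanced_vertex_true hn hl hl' w (!a) (!a')
      (fun h => by simp [← h₀ h]) (fun h => by simp [← h₁ h])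
    exact ⟨_, hb.not, by simp [h0], by simp [h2], by simp [h3]⟩
  · exact exists_balanced_vertex_true hn hl hl' w a a' (fun h => (h₀ h).symm) fun h => (h₁ h).symm

theorem exists_balanced_ne {n l : ℕ} (hn : 3 ≤ n) (hl : 1 ≤ l) (hl' : l ≤ n)
    {w w' : ℕ} (hw : w ≠ w') : ∃ b, IsBalanced n l b ∧ b w ≠ b w' := by
  wlog h : w ≠ 0 ∧ w ≠ 2 * n generalizing w w'
  · by_cases h' : w' ≠ 0 ∧ w' ≠ 2 * n
    · obtain ⟨b, hb, hne⟩ := this hw.symm h'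
      exact ⟨b, hb, hne.symm⟩
    · obtain ⟨b, hb, h0, h2, -⟩ := exists_balanced_vertex hn hl hl' 0 false true false
        (by simp) (by omega)
      refine ⟨b, hb, ?_⟩
      grind
  · by_cases h' : w' = 0 ∨ w' = 2 * n
    · obtain ⟨b, hb, h0, h2, h3⟩ := exists_balanced_vertex hn hl hl' w false false true
        (by grind) (by grind)
      refine ⟨b, hb, ?_⟩
      grind
    · by_cases h3 : w = n ∨ w' = n
      · obtain ⟨b, h⟩ := exists_isReflection (l := l) False False
          (fun i => i = n ∨ (w = 2 * n + i ∧ w < 3 * n) ∨ (w' = 2 * n + i ∧ w' < 3 * n))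
          hn hl hl' (by simp; omega) (by simp; omega)
        have e : b w = decide (w = n) := h.apply (by simp; omega) (by simp; omega) (by simp; omega)
        have e' : b w' = decide (w' = n) :=
          h.apply (by simp; omega) (by simp; omega) (by simp; omega)
        refine ⟨b, h.balanced, ?_⟩
        rw [e, e', ne_eq, decide_eq_decide]
        omega
      -- Both segments are negated, so a vertex mᵢ receives `false` precisely when i is put into
      -- `β`; this is the role of the last disjunct when `w'` lies on the descending chain.
      · obtain ⟨b, h⟩ := exists_isReflection (l := l) False False
          (fun i => i = 0 ∨ i = 2 * n ∨ i = w ∨ (w' = 2 * n + i ∧ w' < 3 * n ∧ w ≠ 2 * n + i))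
          hn hl hl' (by simp; omega) (by simp; omega)
        have e : b w = true := h.apply (by simp) (by simp; omega) (by simp; omega)
        have e' : b w' = false := h.apply (by simp; omega) (by simp; omega) (by simp; omega)
        exact ⟨b, h.balanced, by simp [e, e']⟩

/-- Negation makes the descending edge opposite to the ascending one once `β` is constant on the
latter. This serves to separate the two images of one inner point in copies with the same label. -/
theorem exists_balanced_constant {n l : ℕ} (hn : 3 ≤ n) (hl : 1 ≤ l) (hl' : l ≤ n)
    (j : ℕ) :
    ∃ b, IsBalanced n l b ∧ ∀ e e' : LadderEdge n, e.label = j → e'.label = j → e ≠ e' →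
      ∃ a, (∀ p, b (e.vertex p) = a) ∧ ∀ p, b (e'.vertex p) = !a := by
  obtain ⟨b, h⟩ := exists_isReflection (l := l) False False
    (fun i => i = 0 ∨ (j = 1 ∧ i = 1) ∨ i = 2 * n) hn hl hl' (by simp; omega) (by simp; omega)
  have low : ∀ e : LadderEdge n, e.label = j → e.1.2 = false → j ≤ n →
      ∀ p, b (e.vertex p) = decide (j = 1) := by
    rintro ⟨⟨i, a⟩, h1, h2, h3⟩ hj ha h4 p
    change i = j at hj
    change a = _ at ha
    subst hj ha
    cases p <;>
    · simp only [LadderEdge.vertex, Bool.false_eq_true, if_false, if_true]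
      rw [Bool.eq_iff_iff, h.lower _ (by omega)]
      simp; omega
  have upp : ∀ e : LadderEdge n, e.label = j → e.1.2 = true → j ≤ n →
      ∀ p, b (e.vertex p) = !decide (j = 1) := by
    rintro ⟨⟨i, a⟩, h1, h2, h3⟩ hj ha h4 p
    change i = j at hj
    change a = _ at ha
    subst hj ha
    cases p <;>
    · simp only [LadderEdge.vertex, Bool.false_eq_true, if_false, if_true]
      rw [Bool.eq_iff_iff, h.upper _ (by omega)]
      simp; omega
  refine ⟨b, h.balanced, fun e e' hj hj' hne => ?_⟩
  have hne' : e.1.2 ≠ e'.1.2 := fun hh => hne (Subtype.ext (Prod.ext (hj.trans hj'.symm) hh))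
  have h1 := e.2.2.2
  have h2 := e'.2.2.2
  change _ → e.label ≤ n at h1
  change _ → e'.label ≤ n at h2
  rw [hj] at h1
  rw [hj'] at h2
  cases he : e.1.2 <;> cases he' : e'.1.2
  · simp [he, he'] at hne'
  · exact ⟨_, low e hj he (h2 he'), upp e' hj' he' (h2 he')⟩
  · exact ⟨_, upp e hj he (h1 he), by simpa using low e' hj' he' (h1 he)⟩
  · simp [he, he'] at hne'

/-- Under negation a two-coloured ascending edge has a descending partner with the same end colours.
Thus any colouring of `V` can be placed on all copies with label `j` at once. -/
theorem exists_balanced_hasEnds {n l : ℕ} (hn : 3 ≤ n) (hl : 1 ≤ l) (hl' : l ≤ n)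
    {j : ℕ} (hjl : j ≠ l) (a a' : Bool) :
    ∃ b, IsBalanced n l b ∧ HasEnds n j b a a' := by
  by_cases hj : 1 ≤ j ∧ j ≤ 2 * n
  swap
  · exact ⟨fun _ => a, isBalanced_const _ _ _, hasEnds_of_notMem hj _ _ _⟩
  suffices ∃ b, IsBalanced n l b ∧ HasEnds n j b true false by
    obtain ⟨b, hb, h⟩ := this
    cases a <;> cases a'
    · exact ⟨fun _ => false, isBalanced_const _ _ _, fun _ _ => ⟨rfl, rfl⟩⟩
    · exact ⟨_, hb.not, fun e he => by simpa using h e he⟩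
    · exact ⟨_, hb, h⟩
    · exact ⟨fun _ => true, isBalanced_const _ _ _, fun _ _ => ⟨rfl, rfl⟩⟩
  by_cases hjn : j ≤ n
  · obtain ⟨b, h⟩ := exists_isReflection (l := l) False False (fun i => i < j ∨ i = 2 * n)
      hn hl hl' (by simp; omega) (by simp; omega)
    refine ⟨b, h.balanced, h.hasEnds hj.1 hj.2 hjl ?_ ?_ ?_ ?_⟩ <;> simp <;> omega
  · obtain ⟨b, h⟩ := exists_isReflection (l := l) True False (fun i => i < j)
      hn hl hl' (by simp; omega) (by simp; omega)
    refine ⟨b, h.balanced, h.hasEnds hj.1 hj.2 hjl ?_ ?_ ?_ ?_⟩ <;> simp <;> omega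

/-- Meant for a relation spread over label `j` whose domain misses one end: `a` is `true` if it
misses the source and `false` if it misses the target. The pattern `a`, `!a` gives `true` to the
missed end and `false` to the other, so the whole domain can still be coloured `false` while `w` is
`true`. -/
theorem exists_balanced_avoid {n l : ℕ} (hn : 3 ≤ n) (hl : 1 ≤ l) (hl' : l ≤ n)
    {j : ℕ} (hj : j ≠ l) {w : ℕ} (a : Bool)
    (hw : ∀ e : LadderEdge n, e.label = j → ∀ p, e.vertex p ≠ w) :
    ∃ b, IsBalanced n l b ∧ b w = true ∧ (HasEnds n j b false false ∨ HasEnds n j b a (!a)) := by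
  by_cases hj' : 1 ≤ j ∧ j ≤ 2 * n
  swap
  · exact ⟨fun _ => true, isBalanced_const _ _ _, rfl, .inl (hasEnds_of_notMem hj' _ _ _)⟩
  have w1 : w ≠ j := fun h => hw ⟨(j, false), hj'.1, hj'.2, by simp⟩ rfl true
    (by simp [LadderEdge.vertex, h])
  have w2 : w ≠ j - 1 := fun h => hw ⟨(j, false), hj'.1, hj'.2, by simp⟩ rfl false
    (by simp [LadderEdge.vertex, h])
  have w3 : j ≤ n → w ≠ mirror n j := fun hn h => hw ⟨(j, true), hj'.1, hj'.2, by simpa⟩ rfl false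
    (by simp [LadderEdge.vertex, h])
  have w4 : j ≤ n → w ≠ mirror n (j - 1) := fun hn h =>
    hw ⟨(j, true), hj'.1, hj'.2, by simpa⟩ rfl true (by simp [LadderEdge.vertex, h])
  replace w3 : j ≤ n → if j = n then w ≠ 2 * n else w ≠ 2 * n + j := by
    intro h; have := w3 h; unfold mirror at this; split_ifs at * <;> omega
  replace w4 : j ≤ n → if j = 1 then w ≠ n else w ≠ 2 * n + (j - 1) := by
    intro h; have := w4 h; unfold mirror at this; split_ifs at * <;> omega
  by_cases hjn : j ≤ n
  · replace w3 := w3 hjn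
    replace w4 := w4 hjn
    cases a
    · by_cases s1 : j = 1 ∧ w = 2 * n
      · obtain ⟨b, h⟩ := exists_isReflection (l := l) False True (fun i => i ≠ 0)
          hn hl hl' (by simp; omega) (by simp; omega)
        refine ⟨b, h.balanced, h.apply ?_ ?_ ?_, Or.inr (h.hasEnds hj'.1 hj'.2 hj ?_ ?_ ?_ ?_)⟩ <;>
          simp <;> omega
      by_cases s2 : j = n ∧ w = 0
      · obtain ⟨b, h⟩ := exists_isReflection (l := l) True False (fun i => i ≠ n - 1 ∧ i ≠ 2 * n)
          hn hl hl' (by simp; omega) (by simp; omega)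
        refine ⟨b, h.balanced, h.apply ?_ ?_ ?_, Or.inr (h.hasEnds hj'.1 hj'.2 hj ?_ ?_ ?_ ?_)⟩ <;>
          simp <;> omega
      by_cases s3 : j = 1 ∨ j = n ∨ w = n
      · obtain ⟨b, h⟩ := exists_isReflection (l := l) False False (fun i => i = n ∨ i = j ∨ i = w)
          hn hl hl' (by simp; split_ifs at * <;> omega) (by simp; split_ifs at * <;> omega)
        refine ⟨b, h.balanced, h.apply ?_ ?_ ?_, Or.inr (h.hasEnds hj'.1 hj'.2 hj ?_ ?_ ?_ ?_)⟩ <;>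
          simp <;> split_ifs at * <;> omega
      · obtain ⟨b, h⟩ := exists_isReflection (l := l) False False
          (fun i => i = 0 ∨ i = 2 * n ∨ i = j ∨ i = w)
          hn hl hl' (by simp; split_ifs at * <;> omega) (by simp; split_ifs at * <;> omega)
        refine ⟨b, h.balanced, h.apply ?_ ?_ ?_, Or.inr (h.hasEnds hj'.1 hj'.2 hj ?_ ?_ ?_ ?_)⟩ <;>
          simp <;> split_ifs at * <;> omega
    · by_cases s3 : w = n
      · obtain ⟨b, h⟩ := exists_isReflection (l := l) False False
          (fun i => i = n ∨ i = j - 1)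
          hn hl hl' (by simp; split_ifs at * <;> omega) (by simp; split_ifs at * <;> omega)
        refine ⟨b, h.balanced, h.apply ?_ ?_ ?_, Or.inr (h.hasEnds hj'.1 hj'.2 hj ?_ ?_ ?_ ?_)⟩ <;>
          simp <;> split_ifs at * <;> omega
      · obtain ⟨b, h⟩ := exists_isReflection (l := l) False False
          (fun i => i = 0 ∨ i = 2 * n ∨ i = j - 1 ∨ i = w)
          hn hl hl' (by simp; split_ifs at * <;> omega) (by simp; split_ifs at * <;> omega)
        refine ⟨b, h.balanced, h.apply ?_ ?_ ?_, Or.inr (h.hasEnds hj'.1 hj'.2 hj ?_ ?_ ?_ ?_)⟩ <;>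
          simp <;> split_ifs at * <;> omega
  · clear w3 w4
    by_cases s1 : w = n
    · obtain ⟨b, h⟩ := exists_isReflection (l := l) False False (fun i => i = n)
          hn hl hl' (by simp; omega) (by simp; omega)
      refine ⟨b, h.balanced, h.apply ?_ ?_ ?_, Or.inl (h.hasEnds hj'.1 hj'.2 hj ?_ ?_ ?_ ?_)⟩ <;>
          simp <;> omega
    by_cases s2 : j = 2 * n
    · by_cases s3 : w = 0
      · obtain ⟨b, h⟩ := exists_isReflection (l := l) False True (fun i => i = 0)
          hn hl hl' (by simp; omega) (by simp; omega)
        refine ⟨b, h.balanced, h.apply ?_ ?_ ?_, Or.inl (h.hasEnds hj'.1 hj'.2 hj ?_ ?_ ?_ ?_)⟩ <;>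
          simp <;> omega
      · obtain ⟨b, h⟩ := exists_isReflection (l := l) False False (fun i => i = n ∨ i = w)
          hn hl hl' (by simp; omega) (by simp; omega)
        refine ⟨b, h.balanced, h.apply ?_ ?_ ?_, Or.inl (h.hasEnds hj'.1 hj'.2 hj ?_ ?_ ?_ ?_)⟩ <;>
          simp <;> omega
    · obtain ⟨b, h⟩ := exists_isReflection (l := l) False False (fun i => i = 0 ∨ i = 2 * n ∨ i = w)
          hn hl hl' (by simp; omega) (by simp; omega)
      refine ⟨b, h.balanced, h.apply ?_ ?_ ?_, Or.inl (h.hasEnds hj'.1 hj'.2 hj ?_ ?_ ?_ ?_)⟩ <;>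
          simp <;> omega

/-- The convention for `a` is that of `exists_balanced_avoid`. An edge with label 1 starts at 0,
whose colour is prescribed, and this forces `a` when `j = 1`. -/
theorem exists_balanced_source {n l : ℕ} (hn : 3 ≤ n) (hl : 1 ≤ l) (hl' : l ≤ n)
    {j : ℕ} (hj : j ≠ l) (a : Bool) (h : j = 1 → a = true) :
    ∃ b, IsBalanced n l b ∧ b 0 = true ∧ b (2 * n) = false ∧
      (HasEnds n j b false false ∨ HasEnds n j b a (!a)) := by
  by_cases hj' : 1 ≤ j ∧ j ≤ 2 * n
  swap
  · obtain ⟨b, hb, h0, h2, -⟩ := exists_balanced_vertex hn hl hl' 0 true false true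
      (by simp) (by omega)
    exact ⟨b, hb, h0, h2, .inl (hasEnds_of_notMem hj' _ _ _)⟩
  by_cases hjl : j < l
  · cases a
    · simp at h
      obtain ⟨b, h⟩ := exists_isReflection (l := l) False True (fun i => i = 0 ∨ i = j)
        hn hl hl' (by simp; omega) (by simp; omega)
      refine ⟨b, h.balanced, h.apply ?_ ?_ ?_, h.apply ?_ ?_ ?_,
        Or.inr (h.hasEnds hj'.1 hj'.2 hj ?_ ?_ ?_ ?_)⟩ <;> simp <;> omega
    · obtain ⟨b, h⟩ := exists_isReflection (l := l) False True (fun i => i < j)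
        hn hl hl' (by simp; omega) (by simp; omega)
      refine ⟨b, h.balanced, h.apply ?_ ?_ ?_, h.apply ?_ ?_ ?_,
        Or.inr (h.hasEnds hj'.1 hj'.2 hj ?_ ?_ ?_ ?_)⟩ <;> simp <;> omega
  · obtain ⟨b, h⟩ := exists_isReflection (l := l) False True (fun i => i = 0)
      hn hl hl' (by simp; omega) (by simp; omega)
    refine ⟨b, h.balanced, h.apply ?_ ?_ ?_, h.apply ?_ ?_ ?_,
      Or.inl (h.hasEnds hj'.1 hj'.2 hj ?_ ?_ ?_ ?_)⟩ <;> simp <;> omega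

/-- The vertex 2n is the source of the descending edge with label n and the target of the edge with
label 2n, which forces `a` in these two cases. -/
theorem exists_balanced_target {n l : ℕ} (hn : 3 ≤ n) (hl : 1 ≤ l) (hl' : l ≤ n)
    {j : ℕ} (hj : j ≠ l) (a : Bool) (h : j = n → a = true)
    (h' : j = 2 * n → a = false) :
    ∃ b, IsBalanced n l b ∧ b 0 = false ∧ b (2 * n) = true ∧
      (HasEnds n j b false false ∨ HasEnds n j b a (!a)) := by
  by_cases hj' : 1 ≤ j ∧ j ≤ 2 * n
  swap
  · obtain ⟨b, hb, h0, h2, -⟩ := exists_balanced_vertex hn hl hl' 0 false true false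
      (by simp) (by omega)
    exact ⟨b, hb, h0, h2, .inl (hasEnds_of_notMem hj' _ _ _)⟩
  by_cases hjl : l < j ∧ j ≤ n ∨ j = 2 * n
  · cases a
    · simp at h
      obtain ⟨b, h⟩ := exists_isReflection (l := l) True False (fun i => i = 2 * n ∨ i = j)
        hn hl hl' (by simp; omega) (by simp; omega)
      refine ⟨b, h.balanced, h.apply ?_ ?_ ?_, h.apply ?_ ?_ ?_,
        Or.inr (h.hasEnds hj'.1 hj'.2 hj ?_ ?_ ?_ ?_)⟩ <;> simp <;> omega
    · simp at h'
      obtain ⟨b, h⟩ := exists_isReflection (l := l) True False (fun i => i = 2 * n ∨ i = j - 1)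
        hn hl hl' (by simp; omega) (by simp; omega)
      refine ⟨b, h.balanced, h.apply ?_ ?_ ?_, h.apply ?_ ?_ ?_,
        Or.inr (h.hasEnds hj'.1 hj'.2 hj ?_ ?_ ?_ ?_)⟩ <;> simp <;> omega
  · obtain ⟨b, h⟩ := exists_isReflection (l := l) True False (fun i => i = 2 * n)
      hn hl hl' (by simp; omega) (by simp; omega)
    refine ⟨b, h.balanced, h.apply ?_ ?_ ?_, h.apply ?_ ?_ ?_,
      Or.inl (h.hasEnds hj'.1 hj'.2 hj ?_ ?_ ?_ ?_)⟩ <;> simp <;> omega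

/-! ### Binary relations and compatible two-colourings -/

/-- Binary relations on `V`, multiplied by composition. -/
def BinRel (V : Type v) : Type v := V → V → Prop

namespace BinRel

variable {V : Type v}

theorem ext {f g : BinRel V} (h : ∀ x y, f x y ↔ g x y) : f = g :=
  funext₂ fun x y => propext (h x y)

instance : Monoid (BinRel V) where
  mul f g := fun x z => ∃ y, f x y ∧ g y z
  one := fun x y => x = y
  mul_assoc f g h := ext fun x z =>
    ⟨fun ⟨y, ⟨y', h₁, h₂⟩, h₃⟩ => ⟨y', h₁, y, h₂, h₃⟩,
      fun ⟨y, h₁, y', h₂, h₃⟩ => ⟨y', ⟨y, h₁, h₂⟩, h₃⟩⟩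
  one_mul f := ext fun x z => ⟨fun ⟨y, h₁, h₂⟩ => by cases h₁; exact h₂, fun h => ⟨x, rfl, h⟩⟩
  mul_one f := ext fun x z => ⟨fun ⟨y, h₁, h₂⟩ => by cases h₂; exact h₁, fun h => ⟨z, h, rfl⟩⟩

theorem mul_apply {f g : BinRel V} {x z : V} : (f * g) x z ↔ ∃ y, f x y ∧ g y z := Iff.rfl

theorem one_apply {x y : V} : (1 : BinRel V) x y ↔ x = y := Iff.rfl

/-- The converse relation. -/
def converse (f : BinRel V) : BinRel V := fun x y => f y x

/-- The empty relation. -/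
def empty : BinRel V := fun _ _ => False

/-- The relation consists of at most one pair. -/
def IsSlim (f : BinRel V) : Prop := ∀ ⦃x y x' y'⦄, f x y → f x' y' → x = x' ∧ y = y'

theorem isSlim_empty : (empty : BinRel V).IsSlim := fun _ _ _ _ h => h.elim

/-- The relation preserves the colours given by `c`, or leads from a fixed colour to a fixed
colour. -/
def IsCompatible (c : V → Bool) (f : BinRel V) : Prop :=
  (∀ x y, f x y → c x = c y) ∨ ∃ a a', ∀ x y, f x y → c x = a ∧ c y = a'

theorem isCompatible_const (a : Bool) (f : BinRel V) : IsCompatible (fun _ => a) f :=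
  Or.inl fun _ _ _ => rfl

theorem IsSlim.isCompatible {f : BinRel V} (hf : f.IsSlim) (c : V → Bool) : IsCompatible c f := by
  by_cases h : ∃ x y, f x y
  · obtain ⟨x, y, h⟩ := h
    exact Or.inr ⟨c x, c y, fun x' y' h' => by simp [hf h h']⟩
  · exact Or.inl fun x y h' => absurd ⟨x, y, h'⟩ h

theorem IsCompatible.not {c : V → Bool} {f : BinRel V} (h : IsCompatible c f) :
    IsCompatible (fun x => !c x) f := by
  rcases h with h | ⟨a, a', h⟩
  · exact Or.inl fun x y hxy => by simp [h x y hxy]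
  · exact Or.inr ⟨!a, !a', fun x y hxy => by simp [h x y hxy]⟩

theorem IsSlim.dom_subsingleton {f : BinRel V} (hf : f.IsSlim) :
    (∀ x y, ¬f x y) ∨ ∃ z, (∃ y, f z y) ∧ ∀ x y, f x y → x = z := by
  by_cases h : ∃ x y, f x y
  · obtain ⟨z, y, h⟩ := h
    exact Or.inr ⟨z, ⟨y, h⟩, fun x' y' h' => (hf h' h).1⟩
  · push Not at h
    exact Or.inl h

end BinRel

/-! ### Frames -/

open BinRel

/-- A sequence of members of `T` with at most `k` nonempty terms, namely the first ones. -/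
def IsFamily {V : Type v} (k : ℕ) (T : Set (BinRel V)) (F : ℕ → BinRel V) : Prop :=
  (∀ i, F i ∈ T) ∧ ∀ i, k ≤ i → ∀ x y, ¬F i x y

/-- A set `T` of partial injections of `V` that is closed under products and converses and admits
sufficiently many two-colourings compatible with any `k` of its members; `s` and `t` are never both
in the domain of a member. -/
structure IsFrame {V : Type v} (k : ℕ) (s t : V) (T : Set (BinRel V)) : Prop where
  ne : s ≠ t
  slim_mem : ∀ {f}, f.IsSlim → f ∈ T
  mul_mem : ∀ {f g}, f ∈ T → g ∈ T → f * g ∈ T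
  converse_mem : ∀ {f}, f ∈ T → f.converse ∈ T
  unique : ∀ {f}, f ∈ T → ∀ {x y y'}, f x y → f x y' → y = y'
  ends : ∀ {f}, f ∈ T → ∀ {x y}, f s x → ¬f t y
  sep_dom : ∀ {F}, IsFamily k T F → ∀ {f}, f ∈ T → ∀ {x}, (∀ y, ¬f x y) →
    ∃ c, (∀ i, IsCompatible c (F i)) ∧ c x = true ∧ ∀ x' y', f x' y' → c x' = false
  sep : ∀ {F}, IsFamily k T F → ∀ {x y}, x ≠ y → ∃ c, (∀ i, IsCompatible c (F i)) ∧ c x ≠ c y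
  sep_ends : ∀ {F}, IsFamily k T F → ∀ x a a' d, (x = s → d = a) → (x = t → d = a') →
    ∃ c, (∀ i, IsCompatible c (F i)) ∧ c s = a ∧ c t = a' ∧ c x = d
  sep_source : ∀ {F}, IsFamily k T F → ∀ {f}, f ∈ T → (∀ y, ¬f s y) →
    ∃ c, (∀ i, IsCompatible c (F i)) ∧ c s = true ∧ c t = false ∧ ∀ x y, f x y → c x = false
  sep_target : ∀ {F}, IsFamily k T F → ∀ {f}, f ∈ T → (∀ y, ¬f t y) →
    ∃ c, (∀ i, IsCompatible c (F i)) ∧ c s = false ∧ c t = true ∧ ∀ x y, f x y → c x = false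

theorem IsFrame.ends_right {V : Type v} {k : ℕ} {s t : V} {T : Set (BinRel V)}
    (hT : IsFrame k s t T) {f : BinRel V} (hf : f ∈ T) {p p' : Bool} {x x' : V}
    (h : f x (cond p t s)) (h' : f x' (cond p' t s)) : p = p' := by
  have := hT.ends (hT.converse_mem hf) (x := x) (y := x')
  have := hT.ends (hT.converse_mem hf) (x := x') (y := x)
  cases p <;> cases p' <;> simp_all [converse]

/-- The frame with two points. -/
theorem isFrame_two {V : Type v} (k : ℕ) {s t : V} (hst : s ≠ t) (hV : ∀ x, x = s ∨ x = t) :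
    IsFrame k s t {f | f.IsSlim} := by
  classical
  have comp : ∀ {F}, IsFamily k {f : BinRel V | f.IsSlim} F → ∀ c i, IsCompatible c (F i) :=
    fun hF c i => IsSlim.isCompatible (hF.1 i) c
  refine ⟨hst, id, ?_, ?_, ?_, ?_, ?_, ?_, ?_, ?_, ?_⟩
  · rintro f g hf hg x y x' y' ⟨z, h₁, h₂⟩ ⟨z', h₁', h₂'⟩
    exact ⟨(hf h₁ h₁').1, (hg h₂ h₂').2⟩
  · intro f hf x y x' y' h h'
    exact (hf h h').symm
  · intro f hf x y y' h h'
    exact (hf h h').2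
  · intro f hf x y h h'
    exact hst (hf h h').1
  · intro F hF f hf x hx
    refine ⟨fun z => decide (z = x), comp hF _, by simp, fun x' y' h => ?_⟩
    simp only [decide_eq_false_iff_not]
    rintro rfl
    exact hx _ h
  · intro F hF x y hxy
    exact ⟨fun z => decide (z = x), comp hF _, by simpa using hxy.symm⟩
  · intro F hF x a a' d h h'
    refine ⟨fun z => if z = s then a else a', comp hF _, by simp, by simp [hst.symm], ?_⟩
    rcases hV x with rfl | rfl
    · simp [h rfl]
    · simp [h' rfl, hst.symm]
  · intro F hF f hf hs
    refine ⟨fun z => decide (z = s), comp hF _, by simp, by simp [hst.symm], fun x y h => ?_⟩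
    simp only [decide_eq_false_iff_not]
    rintro rfl
    exact hs _ h
  · intro F hF f hf hs
    refine ⟨fun z => decide (z = t), comp hF _, by simp [hst], by simp, fun x y h => ?_⟩
    simp only [decide_eq_false_iff_not]
    rintro rfl
    exact hs _ h

/-! ### Replacing the edges of the ladder graph by copies of a frame -/

namespace LadderEdge

variable {n j : ℕ}

/-- The edge `j - 1 ⟶ j`. -/
def up (h : 1 ≤ j) (h' : j ≤ 2 * n) : LadderEdge n := ⟨(j, false), h, h', by simp⟩

/-- The edge `mⱼ ⟶ mⱼ₋₁`. -/
def down (h : 1 ≤ j) (h' : j ≤ n) : LadderEdge n :=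
  ⟨(j, true), h, by dsimp only; omega, fun _ => h'⟩

theorem label_up (h : 1 ≤ j) (h' : j ≤ 2 * n) : (up h h').label = j := rfl

theorem label_down (h : 1 ≤ j) (h' : j ≤ n) : (down h h').label = j := rfl

theorem vertex_up (h : 1 ≤ j) (h' : j ≤ 2 * n) (p : Bool) :
    (up h h').vertex p = cond p j (j - 1) := by
  cases p <;> rfl

theorem vertex_down (h : 1 ≤ j) (h' : j ≤ n) (p : Bool) :
    (down h h').vertex p = mirror n (cond p (j - 1) j) := by
  cases p <;> rfl

end LadderEdge

/-- The vertices of the ladder graph together with the inner points of a copy of `V` for each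
edge. -/
inductive LadderPoint {V : Type v} (n : ℕ) (s t : V) : Type v
  | base (w : ℕ) : LadderPoint n s t
  | inner (e : LadderEdge n) (x : V) (hx : x ≠ s ∧ x ≠ t) : LadderPoint n s t

section Ladder

variable {V : Type v} {n k : ℕ} {s t : V} {T : Set (BinRel V)}

open Classical in
/-- The copy of `V` that replaces the edge `e`. -/
noncomputable def embed (s t : V) (e : LadderEdge n) (x : V) : LadderPoint n s t :=
  if h : x ≠ s ∧ x ≠ t then .inner e x h else .base (e.vertex (decide (x ≠ s)))

theorem embed_end (hst : s ≠ t) (e : LadderEdge n) (p : Bool) :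
    embed s t e (cond p t s) = LadderPoint.base (e.vertex p) := by
  cases p <;> simp [embed, hst.symm]

theorem embed_source (hst : s ≠ t) (e : LadderEdge n) :
    embed s t e s = LadderPoint.base (e.vertex false) := embed_end hst e false

theorem embed_target (hst : s ≠ t) (e : LadderEdge n) :
    embed s t e t = LadderPoint.base (e.vertex true) := embed_end hst e true

theorem eq_cond_or (s t x : V) : (∃ p, x = cond p t s) ∨ (x ≠ s ∧ x ≠ t) := by
  by_cases h : x = s
  · exact Or.inl ⟨false, h⟩
  · by_cases h' : x = t
    · exact Or.inl ⟨true, h'⟩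
    · exact Or.inr ⟨h, h'⟩

theorem embed_eq_base (hst : s ≠ t) {e : LadderEdge n} {x : V} {w : ℕ}
    (h : embed s t e x = LadderPoint.base w) : ∃ p, x = cond p t s ∧ e.vertex p = w := by
  rcases eq_cond_or s t x with ⟨p, rfl⟩ | hx
  · exact ⟨p, rfl, LadderPoint.base.inj ((embed_end hst e p).symm.trans h)⟩
  · rw [embed, dif_pos hx] at h
    cases h

theorem embed_eq_embed (hst : s ≠ t) {e e' : LadderEdge n} {x x' : V}
    (h : embed s t e x = embed s t e' x') : (e = e' ∧ x = x') ∨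
      ∃ p p', x = cond p t s ∧ x' = cond p' t s ∧ e.vertex p = e'.vertex p' := by
  rcases eq_cond_or s t x' with ⟨p', rfl⟩ | hx'
  · rw [embed_end hst] at h
    obtain ⟨p, h₁, h₂⟩ := embed_eq_base hst h
    exact Or.inr ⟨p, p', h₁, rfl, h₂⟩
  · rcases eq_cond_or s t x with ⟨p, rfl⟩ | hx
    · rw [embed_end hst] at h
      obtain ⟨p', h₁, h₂⟩ := embed_eq_base hst h.symm
      exact Or.inr ⟨p, p', rfl, h₁, h₂.symm⟩
    · rw [embed, dif_pos hx, embed, dif_pos hx'] at h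
      exact Or.inl (LadderPoint.inner.inj h)

theorem eq_of_embed_eq (hn : 3 ≤ n) (hst : s ≠ t) {e e' : LadderEdge n} {x x' : V}
    (hl : e.label = e'.label) (h : embed s t e x = embed s t e' x') : e = e' ∧ x = x' := by
  rcases embed_eq_embed hst h with h | ⟨p, p', rfl, rfl, hv⟩
  · exact h
  · obtain ⟨rfl, rfl⟩ := LadderEdge.eq_of_vertex_eq hn hl hv
    exact ⟨rfl, rfl⟩

theorem LadderPoint.cases (X : LadderPoint n s t) :
    (∃ w, X = LadderPoint.base w) ∨ ∃ e x, x ≠ s ∧ x ≠ t ∧ X = embed s t e x := by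
  rcases X with w | ⟨e, x, hx⟩
  · exact Or.inl ⟨w, rfl⟩
  · exact Or.inr ⟨e, x, hx.1, hx.2, by rw [embed, dif_pos hx]⟩

/-- The relation `g`, transported to all edges with label `j`. -/
def spread (n : ℕ) (s t : V) (j : ℕ) (g : BinRel V) : BinRel (LadderPoint n s t) := fun X Y =>
  ∃ e : LadderEdge n, e.label = j ∧ ∃ x y, g x y ∧ embed s t e x = X ∧ embed s t e y = Y

theorem spread_apply {j : ℕ} {g : BinRel V} {e : LadderEdge n} {x y : V} (hl : e.label = j)
    (h : g x y) : spread n s t j g (embed s t e x) (embed s t e y) :=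
  ⟨e, hl, x, y, h, rfl, rfl⟩

/-- The relations with at most one pair and those spread over the edges of some label. -/
def spreadSet (n : ℕ) (s t : V) (T : Set (BinRel V)) : Set (BinRel (LadderPoint n s t)) :=
  {f | f.IsSlim ∨ ∃ j, ∃ g ∈ T, f = spread n s t j g}

/-! ### Closure of the spread relations under converse and product -/

theorem spread_unique (hT : IsFrame k s t T) (hn : 3 ≤ n) {f : BinRel (LadderPoint n s t)}
    (hf : f ∈ spreadSet n s t T) {X Y Y'} (h : f X Y) (h' : f X Y') : Y = Y' := by
  rcases hf with hf | ⟨j, g, hg, rfl⟩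
  · exact (hf h h').2
  · obtain ⟨e, hl, x, y, hxy, rfl, rfl⟩ := h
    obtain ⟨e', hl', x', y', hxy', hX, rfl⟩ := h'
    obtain ⟨rfl, rfl⟩ := eq_of_embed_eq hn hT.ne (hl'.trans hl.symm) hX
    rw [hT.unique hg hxy hxy']

theorem spread_converse (j : ℕ) (g : BinRel V) :
    (spread n s t j g).converse = spread n s t j g.converse :=
  BinRel.ext fun X Y => by
    constructor
    · rintro ⟨e, hl, x, y, hxy, hX, hY⟩
      exact ⟨e, hl, y, x, hxy, hY, hX⟩
    · rintro ⟨e, hl, x, y, hxy, hX, hY⟩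
      exact ⟨e, hl, y, x, hxy, hY, hX⟩

theorem converse_mem_spreadSet (hT : IsFrame k s t T) {f : BinRel (LadderPoint n s t)}
    (hf : f ∈ spreadSet n s t T) : f.converse ∈ spreadSet n s t T := by
  rcases hf with hf | ⟨j, g, hg, rfl⟩
  · exact Or.inl fun x y x' y' h h' => (hf h h').symm
  · exact Or.inr ⟨j, _, hT.converse_mem hg, spread_converse j g⟩

theorem spread_unique_left (hT : IsFrame k s t T) (hn : 3 ≤ n) {f : BinRel (LadderPoint n s t)}
    (hf : f ∈ spreadSet n s t T) {X X' Y} (h : f X Y) (h' : f X' Y) : X = X' :=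
  spread_unique hT hn (converse_mem_spreadSet hT hf) (f := f.converse) h h'

/-- Equal labels compose copy by copy. For different labels, copies meet only in their ends; the
frame property `ends` fixes which end each factor can use, and `LadderEdge.eq_of_meet` then leaves a
single meeting point. -/
theorem mul_mem_spreadSet (hT : IsFrame k s t T) (hn : 3 ≤ n) {f g : BinRel (LadderPoint n s t)}
    (hf : f ∈ spreadSet n s t T) (hg : g ∈ spreadSet n s t T) : f * g ∈ spreadSet n s t T := by
  rcases id hf with hf' | ⟨i, f, hf', rfl⟩
  · left
    rintro X Y X' Y' ⟨Z, h₁, h₂⟩ ⟨Z', h₁', h₂'⟩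
    obtain ⟨rfl, rfl⟩ := hf' h₁ h₁'
    exact ⟨rfl, spread_unique hT hn hg h₂ h₂'⟩
  rcases id hg with hg' | ⟨j, g, hg', rfl⟩
  · left
    rintro X Y X' Y' ⟨Z, h₁, h₂⟩ ⟨Z', h₁', h₂'⟩
    obtain ⟨rfl, rfl⟩ := hg' h₂ h₂'
    exact ⟨spread_unique_left hT hn hf h₁ h₁', rfl⟩
  by_cases hij : i = j
  · subst hij
    refine Or.inr ⟨i, f * g, hT.mul_mem hf' hg', BinRel.ext fun X Y => ⟨?_, ?_⟩⟩
    · rintro ⟨_, ⟨e, hl, x, y, hxy, rfl, rfl⟩, ⟨e', hl', x', y', hxy', hX, rfl⟩⟩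
      obtain ⟨rfl, rfl⟩ := eq_of_embed_eq hn hT.ne (hl'.trans hl.symm) hX
      exact spread_apply hl ⟨_, hxy, hxy'⟩
    · rintro ⟨e, hl, x, y, ⟨z, h₁, h₂⟩, rfl, rfl⟩
      exact ⟨_, spread_apply hl h₁, spread_apply hl h₂⟩
  · left
    have key : ∀ {Z Z'}, (∃ X, spread n s t i f X Z) → (∃ Y, spread n s t j g Z Y) →
        (∃ X, spread n s t i f X Z') → (∃ Y, spread n s t j g Z' Y) → Z = Z' := by
      rintro _ _ ⟨_, e₁, l₁, x₁, y₁, h₁, rfl, rfl⟩ ⟨_, e₁', l₁', x₁', y₁', h₁', hZ, rfl⟩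
        ⟨_, e₂, l₂, x₂, y₂, h₂, rfl, rfl⟩ ⟨_, e₂', l₂', x₂', y₂', h₂', hZ', rfl⟩
      rcases embed_eq_embed hT.ne hZ with ⟨rfl, -⟩ | ⟨p₁, q₁, rfl, rfl, hv⟩
      · exact absurd (l₁.symm.trans l₁') hij
      rcases embed_eq_embed hT.ne hZ' with ⟨rfl, -⟩ | ⟨p₂, q₂, rfl, rfl, hv'⟩
      · exact absurd (l₂.symm.trans l₂') hij
      obtain rfl := hT.ends_right hf' h₁ h₂
      obtain rfl := hT.ends_right (hT.converse_mem hg') (f := g.converse) h₁' h₂'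
      rw [LadderEdge.eq_of_meet hn (l₁.trans l₂.symm) (l₁'.trans l₂'.symm) (by omega) hv.symm
        hv'.symm]
    rintro X Y X' Y' ⟨Z, hXZ, hZY⟩ ⟨Z', hXZ', hZY'⟩
    obtain rfl := key ⟨_, hXZ⟩ ⟨_, hZY⟩ ⟨_, hXZ'⟩ ⟨_, hZY'⟩
    have hX := spread_unique_left hT hn hf hXZ hXZ'
    exact ⟨hX, spread_unique hT hn hg hZY hZY'⟩

/-! ### From balanced to compatible colourings -/

/-- The families `G j` of relations on `V` account for those members of `F` that have more than one
pair, and no label `l` is needed. -/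
def IsSplitting (k l : ℕ) (T : Set (BinRel V)) (F : ℕ → BinRel (LadderPoint n s t))
    (G : ℕ → ℕ → BinRel V) : Prop :=
  (∀ j, IsFamily k T (G j)) ∧ ∀ i, (F i).IsSlim ∨ ∃ j, j ≠ l ∧ F i = spread n s t j (G j i)

theorem exists_notMem_labels (hk : k + 2 ≤ n) (L : ℕ → ℕ) (m : ℕ) :
    ∃ l, 1 ≤ l ∧ l ≤ n ∧ m ≠ l ∧ ∀ i < k, L i ≠ l := by
  have hcard : (insert m ((Finset.range k).image L)).card < (Finset.Icc 1 n).card := by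
    have h₁ := Finset.card_insert_le m ((Finset.range k).image L)
    have h₂ := Finset.card_image_le (s := Finset.range k) (f := L)
    simp only [Finset.card_range, Nat.card_Icc] at *
    omega
  obtain ⟨l, hl, hl'⟩ := Finset.exists_mem_notMem_of_card_lt_card hcard
  simp only [Finset.mem_insert, Finset.mem_image, Finset.mem_range, not_or, not_exists,
    not_and, Finset.mem_Icc] at hl hl'
  exact ⟨l, hl.1, hl.2, fun h => hl'.1 h.symm, hl'.2⟩

theorem exists_isSplitting (hT : IsFrame k s t T) (hk : k + 2 ≤ n)
    {F : ℕ → BinRel (LadderPoint n s t)} (hF : IsFamily k (spreadSet n s t T) F) (m : ℕ) :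
    ∃ l G, 1 ≤ l ∧ l ≤ n ∧ m ≠ l ∧ IsSplitting k l T F G := by
  classical
  have h : ∀ i, ∃ j g, g ∈ T ∧ ((F i).IsSlim ∨ F i = spread n s t j g) := by
    intro i
    rcases hF.1 i with h | ⟨j, g, hg, h⟩
    · exact ⟨0, empty, hT.slim_mem isSlim_empty, Or.inl h⟩
    · exact ⟨j, g, hg, Or.inr h⟩
  choose L g hg h using h
  obtain ⟨l, h1, h2, h3, h4⟩ := exists_notMem_labels hk L m
  -- The members of label `j` keep their positions and all others become empty, so each `G j` is
  -- again a family with bound `k` and the inductive hypothesis on the frame applies to it.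
  refine ⟨l, fun j i => if i < k ∧ L i = j then g i else empty, h1, h2, h3, ?_, ?_⟩
  · intro j
    refine ⟨fun i => ?_, fun i hi x y => ?_⟩
    · by_cases h : i < k ∧ L i = j
      · simpa only [if_pos h] using hg i
      · simpa only [if_neg h] using hT.slim_mem isSlim_empty
    · have e : (if i < k ∧ L i = j then g i else empty) = empty :=
        if_neg fun h => absurd h.1 (not_lt.mpr hi)
      exact (congrFun (congrFun e x) y).mp
  · intro i
    by_cases hi : i < k
    · rcases h i with h | h
      · exact Or.inl h
      · exact Or.inr ⟨L i, h4 i hi, by simpa [hi] using h⟩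
    · exact Or.inl fun x y _ _ h => (hF.2 i (not_lt.mp hi) x y h).elim

theorem exists_coloring_of_edges (hst : s ≠ t) (b : ℕ → Bool) (D : LadderEdge n → V → Bool)
    (hD : ∀ e p, D e (cond p t s) = b (e.vertex p)) :
    ∃ c : LadderPoint n s t → Bool,
      (∀ w, c (LadderPoint.base w) = b w) ∧ ∀ e x, c (embed s t e x) = D e x := by
  refine ⟨fun X => match X with
    | .base w => b w
    | .inner e x _ => D e x, fun w => rfl, fun e x => ?_⟩
  rcases eq_cond_or s t x with ⟨p, rfl⟩ | hx
  · rw [embed_end hst, hD]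
  · rw [embed, dif_pos hx]

/-- A relation leading from one colour to one colour must do so with the same colours in every copy,
so equal colourings of all copies suffice. If instead every copy is monochromatic, colours are
preserved trivially. These are the two cases that balance provides. -/
theorem isCompatible_spread {j : ℕ} {g : BinRel V} {c : LadderPoint n s t → Bool}
    {D : LadderEdge n → V → Bool} (hc : ∀ e x, c (embed s t e x) = D e x)
    (hD : ∀ e, e.label = j → IsCompatible (D e) g)
    (h : (∀ e e', e.label = j → e'.label = j → D e = D e') ∨
      ∀ e, e.label = j → ∀ x y, D e x = D e y) : IsCompatible c (spread n s t j g) := by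
  rcases h with h | h
  · by_cases he : ∃ e : LadderEdge n, e.label = j
    · obtain ⟨e, he⟩ := he
      rcases hD e he with h' | ⟨a, a', h'⟩
      · left
        rintro _ _ ⟨e', he', x, y, hxy, rfl, rfl⟩
        rw [hc, hc, h e' e he' he]
        exact h' x y hxy
      · refine Or.inr ⟨a, a', ?_⟩
        rintro _ _ ⟨e', he', x, y, hxy, rfl, rfl⟩
        rw [hc, hc, h e' e he' he]
        exact h' x y hxy
    · exact Or.inl fun X Y ⟨e, he', _⟩ => absurd ⟨e, he'⟩ he
  · left
    rintro _ _ ⟨e', he', x, y, hxy, rfl, rfl⟩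
    rw [hc, hc]
    exact h e' he' x y

theorem IsBalanced.alternatives {l j : ℕ} {b : ℕ → Bool} (hb : IsBalanced n l b) (hjl : j ≠ l) :
    (∀ e e' : LadderEdge n, e.label = j → e'.label = j → ∀ p, b (e.vertex p) = b (e'.vertex p)) ∨
      ∀ e : LadderEdge n, e.label = j → b (e.vertex false) = b (e.vertex true) := by
  by_cases hj : 1 ≤ j ∧ j ≤ n
  · rcases hb j hj.1 hj.2 hjl with ⟨h, h'⟩ | ⟨h, h'⟩
    · right
      rintro ⟨⟨i, a⟩, h1, h2, h3⟩ he
      change i = j at he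
      subst he
      cases a <;> simp [LadderEdge.vertex, h, h']
    · left
      rintro ⟨⟨i, a⟩, h1, h2, h3⟩ ⟨⟨i', a'⟩, h1', h2', h3'⟩ he he' p
      change i = j at he
      change i' = j at he'
      subst he he'
      cases a <;> cases a' <;> cases p <;> simp [LadderEdge.vertex, h, h']
  · left
    rintro ⟨⟨i, a⟩, h1, h2, h3⟩ ⟨⟨i', a'⟩, h1', h2', h3'⟩ he he' p
    change i = j at he
    change i' = j at he'
    subst he he'
    cases a
    · cases a'
      · rfl
      · exact absurd ⟨h1, h3' rfl⟩ hj
    · exact absurd ⟨h1, h3 rfl⟩ hj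

/-- A balanced colouring of the ladder graph extends to a compatible colouring, with a given
colouring `C` on the edges of one label and a given colour at one inner point for each of the other
labels. -/
theorem exists_compatible (hT : IsFrame k s t T) {l : ℕ} {F : ℕ → BinRel (LadderPoint n s t)}
    {G : ℕ → ℕ → BinRel V} (hFG : IsSplitting k l T F G) {b : ℕ → Bool} (hb : IsBalanced n l b)
    (j : ℕ) (C : V → Bool) (hC : ∀ i, IsCompatible C (G j i)) (hj : HasEnds n j b (C s) (C t))
    (x : ℕ → V) (d : ℕ → Bool) :
    ∃ c, (∀ i, IsCompatible c (F i)) ∧ (∀ w, c (LadderPoint.base w) = b w) ∧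
      (∀ e, e.label = j → ∀ y, c (embed s t e y) = C y) ∧
      (∀ e, e.label ≠ j → x e.label ≠ s → x e.label ≠ t → ∀ p, b (e.vertex p) = d e.label →
        c (embed s t e (x e.label)) = d e.label) ∧
      ∀ e, e.label ≠ j → ∀ a, (∀ p, b (e.vertex p) = a) → ∀ y, c (embed s t e y) = a := by
  classical
  -- The colouring of a copy depends only on its label and its end colours, so edges of one label
  -- with equal end colours receive identical colourings; equal end colours receive the constant
  -- one.
  have h : ∀ j' a a', ∃ D : V → Bool, (∀ i, IsCompatible D (G j' i)) ∧ D s = a ∧ D t = a' ∧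
      (a = a' → ∀ y, D y = a) ∧ (a ≠ a' → x j' ≠ s → x j' ≠ t → D (x j') = d j') := by
    intro j' a a'
    by_cases ha : a = a'
    · exact ⟨fun _ => a, fun i => isCompatible_const a _, rfl, ha, fun _ _ => rfl,
        fun h => absurd ha h⟩
    · by_cases hx : x j' ≠ s ∧ x j' ≠ t
      · obtain ⟨D, h₁, h₂, h₃, h₄⟩ := hT.sep_ends (hFG.1 j') (x j') a a' (d j')
          (fun h => absurd h hx.1) fun h => absurd h hx.2
        exact ⟨D, h₁, h₂, h₃, fun h => absurd h ha, fun _ _ _ => h₄⟩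
      · obtain ⟨D, h₁, h₂, h₃, -⟩ := hT.sep_ends (hFG.1 j') s a a' a (fun _ => rfl)
          fun h => absurd h hT.ne
        exact ⟨D, h₁, h₂, h₃, fun h => absurd h ha, fun _ h h' => absurd ⟨h, h'⟩ hx⟩
  choose D hD hDs hDt hDc hDx using h
  let E (e : LadderEdge n) : V → Bool :=
    if e.label = j then C else D e.label (b (e.vertex false)) (b (e.vertex true))
  have hE : ∀ e : LadderEdge n, e.label = j → E e = C := fun e he => if_pos he
  have hE' : ∀ e : LadderEdge n, e.label ≠ j →
    E e = D e.label (b (e.vertex false)) (b (e.vertex true)) := fun e he => if_neg he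
  obtain ⟨c, hc, hc'⟩ := exists_coloring_of_edges hT.ne b E (by
    intro e p
    by_cases he : e.label = j
    · rw [hE e he]
      cases p
      · exact (hj e he).1.symm
      · exact (hj e he).2.symm
    · rw [hE' e he]
      cases p
      · exact hDs _ _ _
      · exact hDt _ _ _)
  refine ⟨c, fun i => ?_, hc, fun e he y => ?_, fun e he hs ht p hp => ?_,
    fun e he a ha y => ?_⟩
  · rcases hFG.2 i with h | ⟨j', hj', h⟩
    · exact h.isCompatible c
    · rw [h]
      by_cases hjj : j' = j
      · subst hjj
        exact isCompatible_spread hc' (fun e he => by rw [hE e he]; exact hC i)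
          (Or.inl fun e e' he he' => by rw [hE e he, hE e' he'])
      · refine isCompatible_spread hc'
          (fun e he => by rw [hE' e (he ▸ hjj)]; subst he; exact hD _ _ _ i) ?_
        rcases hb.alternatives hj' with h | h
        · left
          intro e e' he he'
          rw [hE' e (he ▸ hjj), hE' e' (he' ▸ hjj), h e e' he he', h e e' he he', he, he']
        · right
          intro e he y z
          rw [hE' e (he ▸ hjj), hDc _ _ _ (h e he), hDc _ _ _ (h e he)]
  · rw [hc', hE e he]
  · rw [hc', hE' e he]
    by_cases ha : b (e.vertex false) = b (e.vertex true)
    · rw [hDc _ _ _ ha, ← hp]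
      cases p
      · rfl
      · exact ha
    · exact hDx _ _ _ ha hs ht
  · rw [hc', hE' e he, hDc _ _ _ ((ha _).trans (ha _).symm), ha]

/-! ### Separation properties of the spread relations -/

theorem spread_ends (hT : IsFrame k s t T) (hn : 3 ≤ n) {f : BinRel (LadderPoint n s t)}
    (hf : f ∈ spreadSet n s t T) {X Y : LadderPoint n s t} (h : f (.base 0) X) : ¬f (.base (2 * n)) Y := by
  intro h'
  rcases hf with hf | ⟨j, g, hg, rfl⟩
  · have := LadderPoint.base.inj (hf h h').1
    omega
  · obtain ⟨e, hl, x, y, hxy, hX, rfl⟩ := h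
    obtain ⟨e', hl', x', y', hxy', hX', rfl⟩ := h'
    obtain ⟨p, rfl, hv⟩ := embed_eq_base hT.ne hX
    obtain ⟨p', rfl, hv'⟩ := embed_eq_base hT.ne hX'
    -- The vertex 0 lies only on label 1, and 2n only on the labels n and 2n; these differ for n ≥
    -- 3.
    have h₁ := LadderEdge.vertex_eq_zero hn hv
    have h₂ := LadderEdge.vertex_eq_two_mul hn hv'
    omega

theorem spread_sep_ends (hT : IsFrame k s t T) (hn : 3 ≤ n) (hk : k + 2 ≤ n)
    {F : ℕ → BinRel (LadderPoint n s t)} (hF : IsFamily k (spreadSet n s t T) F)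
    (X : LadderPoint n s t) (a a' d : Bool) (h₀ : X = .base 0 → d = a)
    (h₁ : X = .base (2 * n) → d = a') :
    ∃ c, (∀ i, IsCompatible c (F i)) ∧ c (.base 0) = a ∧ c (.base (2 * n)) = a' ∧ c X = d := by
  obtain ⟨l, G, hl, hl', -, hG⟩ := exists_isSplitting hT hk hF 0
  rcases X.cases with ⟨w, rfl⟩ | ⟨e, x, hs, ht, rfl⟩
  · obtain ⟨b, hb, b0, b1, bw⟩ := exists_balanced_vertex hn hl hl' w a a' d (fun h => h₀ (h ▸ rfl))
      (fun h => h₁ (h ▸ rfl))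
    -- No edge has label 0, so with `j = 0` the prescribed colouring `C` imposes nothing.
    obtain ⟨c, hc, hc', -⟩ := exists_compatible hT hG hb 0 (fun _ => true)
      (fun _ => isCompatible_const _ _) (hasEnds_of_notMem (by omega) _ _ _) (fun _ => s)
      (fun _ => true)
    exact ⟨c, hc, by rw [hc', b0], by rw [hc', b1], by rw [hc', bw]⟩
  -- No edge joins two of the vertices 0 and 2n. The other end can be coloured `d`, and an inner
  -- point can take the colour of either end of its edge.
  · obtain ⟨p, hp, hp'⟩ : ∃ p, e.vertex p ≠ 0 ∧ e.vertex p ≠ 2 * n := by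
      by_contra! hcon
      have h₁ := hcon true fun h => by simpa using (LadderEdge.vertex_eq_zero hn h).2
      have h₂ := (LadderEdge.vertex_eq_two_mul hn h₁).resolve_left (by simp)
      by_cases h₀ : e.vertex false = 0
      · have := (LadderEdge.vertex_eq_zero hn h₀).1
        omega
      · have := (LadderEdge.vertex_eq_two_mul hn (hcon false h₀)).resolve_right (by simp)
        omega
    obtain ⟨b, hb, b0, b1, bw⟩ := exists_balanced_vertex hn hl hl' (e.vertex p) a a' d
      (fun h => absurd h hp) (fun h => absurd h hp')
    obtain ⟨c, hc, hc', -, hx, -⟩ := exists_compatible hT hG hb 0 (fun _ => true)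
      (fun _ => isCompatible_const _ _) (hasEnds_of_notMem (by omega) _ _ _) (fun _ => x)
      (fun _ => d)
    have := e.label_pos
    exact ⟨c, hc, by rw [hc', b0], by rw [hc', b1], hx e (by omega) hs ht p bw⟩

theorem spread_sep (hT : IsFrame k s t T) (hn : 3 ≤ n) (hk : k + 2 ≤ n)
    {F : ℕ → BinRel (LadderPoint n s t)} (hF : IsFamily k (spreadSet n s t T) F)
    {X Y : LadderPoint n s t} (hXY : X ≠ Y) :
    ∃ c, (∀ i, IsCompatible c (F i)) ∧ c X ≠ c Y := by
  wlog h : (∃ w, Y = .base w) ∨ ∃ e x, x ≠ s ∧ x ≠ t ∧ X = embed s t e x generalizing X Y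
  · rcases Y.cases with hY | hY
    · exact this hXY (Or.inl hY)
    · obtain ⟨c, hc, hne⟩ := this hXY.symm (Or.inr hY)
      exact ⟨c, hc, hne.symm⟩
  rcases X.cases with ⟨w, rfl⟩ | ⟨e, x, hs, ht, rfl⟩
  · obtain ⟨l, G, hl, hl', -, hG⟩ := exists_isSplitting hT hk hF 0
    rcases h with ⟨w', rfl⟩ | ⟨e, x, hs, ht, he⟩
    · obtain ⟨b, hb, hne⟩ := exists_balanced_ne hn hl hl' (w := w) (w' := w')
        fun h => hXY (h ▸ rfl)
      obtain ⟨c, hc, hc', -⟩ := exists_compatible hT hG hb 0 (fun _ => true)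
        (fun _ => isCompatible_const _ _) (hasEnds_of_notMem (by omega) _ _ _) (fun _ => s)
        (fun _ => true)
      exact ⟨c, hc, by rwa [hc', hc']⟩
    · obtain ⟨p, rfl, -⟩ := embed_eq_base hT.ne he.symm
      cases p
      · exact absurd rfl hs
      · exact absurd rfl ht
  · have hpos := e.label_pos
    obtain ⟨l, G, hl, hl', hel, hG⟩ := exists_isSplitting hT hk hF e.label
    rcases Y.cases with ⟨w, rfl⟩ | ⟨e', x', hs', ht', rfl⟩
    · obtain ⟨p, hp⟩ : ∃ p, e.vertex p ≠ w := by
        by_contra! hcon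
        exact e.vertex_ne hn ((hcon _).trans (hcon _).symm)
      obtain ⟨b, hb, hne⟩ := exists_balanced_ne hn hl hl' hp
      obtain ⟨c, hc, hc', -, hx, -⟩ := exists_compatible hT hG hb 0 (fun _ => true)
        (fun _ => isCompatible_const _ _) (hasEnds_of_notMem (by omega) _ _ _) (fun _ => x)
        (fun _ => b (e.vertex p))
      exact ⟨c, hc, by rwa [hc', hx e (by omega) hs ht p rfl]⟩
    · have hpos' := e'.label_pos
      by_cases hlab : e'.label = e.label
      · by_cases hx : x = x'
        · subst hx
          obtain ⟨b, hb, hconst⟩ := exists_balanced_constant hn hl hl' e.label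
          obtain ⟨a, ha, ha'⟩ := hconst e e' rfl hlab (fun h => hXY (h ▸ rfl))
          obtain ⟨c, hc, -, -, -, hx⟩ := exists_compatible hT hG hb 0 (fun _ => true)
            (fun _ => isCompatible_const _ _) (hasEnds_of_notMem (by omega) _ _ _) (fun _ => x)
            (fun _ => a)
          refine ⟨c, hc, ?_⟩
          rw [hx e (by omega) a ha, hx e' (by omega) _ ha']
          simp
        · obtain ⟨C, hC, hne⟩ := hT.sep (hG.1 e.label) hx
          obtain ⟨b, hb, hbe⟩ := exists_balanced_hasEnds hn hl hl' hel (C s) (C t)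
          obtain ⟨c, hc, -, hx, -⟩ := exists_compatible hT hG hb e.label C hC hbe (fun _ => x)
            (fun _ => true)
          exact ⟨c, hc, by rwa [hx e rfl, hx e' hlab]⟩
      -- Copies with different labels are coloured independently, so it is enough to separate one
      -- end of each edge and let the inner points follow.
      · obtain ⟨p, hp⟩ : ∃ p, e.vertex p ≠ e'.vertex false := by
          by_contra! hcon
          exact e.vertex_ne hn ((hcon _).trans (hcon _).symm)
        obtain ⟨b, hb, hne⟩ := exists_balanced_ne hn hl hl' hp
        obtain ⟨c, hc, hc', -, hx, -⟩ := exists_compatible hT hG hb 0 (fun _ => true)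
          (fun _ => isCompatible_const _ _) (hasEnds_of_notMem (by omega) _ _ _)
          (fun j => if j = e.label then x else x')
          (fun j => if j = e.label then b (e.vertex p) else b (e'.vertex false))
        have h₁ := hx e (by omega) (by simpa using hs) (by simpa using ht) p (by simp)
        have h₂ := hx e' (by omega) (by simpa [hlab] using hs') (by simpa [hlab] using ht') false
          (by simp [hlab])
        simp only [if_true, hlab, if_false] at h₁ h₂
        exact ⟨c, hc, by rwa [h₁, h₂]⟩

/-- A relation spread over the edges of a label `j` can be coloured by `false` on its domain together
with a balanced colouring in which the ends of these edges have suitable colours. -/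
theorem exists_compatible_dom (hT : IsFrame k s t T)
    {F : ℕ → BinRel (LadderPoint n s t)} {l j : ℕ} {G : ℕ → ℕ → BinRel V}
    (hFG : IsSplitting k l T F G) {g : BinRel V} (hg : g ∈ T) {a : Bool} (ha : ∀ y, ¬g (cond a s t) y) {b : ℕ → Bool}
    (hb : IsBalanced n l b) (hj : HasEnds n j b false false ∨ HasEnds n j b a (!a)) (x : V) :
    ∃ c, (∀ i, IsCompatible c (F i)) ∧ (∀ w, c (LadderPoint.base w) = b w) ∧
      (∀ X Y, spread n s t j g X Y → c X = false) ∧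
      ∀ e, e.label ≠ j → x ≠ s → x ≠ t → ∀ p, b (e.vertex p) = true → c (embed s t e x) = true := by
  obtain ⟨C, hC, hjC, hCg⟩ : ∃ C : V → Bool, (∀ i, IsCompatible C (G j i)) ∧
      HasEnds n j b (C s) (C t) ∧ ∀ x y, g x y → C x = false := by
    rcases hj with hj | hj
    · exact ⟨fun _ => false, fun _ => isCompatible_const _ _, hj, fun _ _ _ => rfl⟩
    · cases a
      · obtain ⟨C, hC, h₁, h₂, h₃⟩ := hT.sep_target (hFG.1 j) hg ha
        exact ⟨C, hC, by rw [h₁, h₂]; exact hj, h₃⟩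
      · obtain ⟨C, hC, h₁, h₂, h₃⟩ := hT.sep_source (hFG.1 j) hg ha
        exact ⟨C, hC, by rw [h₁, h₂]; exact hj, h₃⟩
  obtain ⟨c, hc, hc', hcC, hx, -⟩ := exists_compatible hT hFG hb j C hC hjC (fun _ => x)
    (fun _ => true)
  refine ⟨c, hc, hc', ?_, hx⟩
  rintro _ _ ⟨e, he, x, y, hxy, rfl, rfl⟩
  rw [hcC e he]
  exact hCg x y hxy

theorem exists_end_notMem_dom (hT : IsFrame k s t T) {g : BinRel V} (hg : g ∈ T) :
    ∃ a, ∀ y, ¬g (cond a s t) y := by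
  by_contra! hcon
  obtain ⟨y, hy⟩ := hcon true
  obtain ⟨z, hz⟩ := hcon false
  exact hT.ends hg hy hz

theorem spread_sep_source (hT : IsFrame k s t T) (hn : 3 ≤ n) (hk : k + 2 ≤ n)
    {F : ℕ → BinRel (LadderPoint n s t)} (hF : IsFamily k (spreadSet n s t T) F)
    {f : BinRel (LadderPoint n s t)} (hf : f ∈ spreadSet n s t T)
    (h₀ : ∀ Y, ¬f (.base 0) Y) :
    ∃ c, (∀ i, IsCompatible c (F i)) ∧ c (.base 0) = true ∧ c (.base (2 * n)) = false ∧
      ∀ X Y, f X Y → c X = false := by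
  rcases hf with hf | ⟨j, g, hg, rfl⟩
  · rcases hf.dom_subsingleton with h | ⟨Z, ⟨Y, hY⟩, hZ⟩
    · obtain ⟨c, hc, h₁, h₂, -⟩ := spread_sep_ends hT hn hk hF (.base 0) true false true
        (fun _ => rfl) (fun h => by have := LadderPoint.base.inj h; omega)
      exact ⟨c, hc, h₁, h₂, fun X Y h' => absurd h' (h X Y)⟩
    · obtain ⟨c, hc, h₁, h₂, h₃⟩ := spread_sep_ends hT hn hk hF Z true false false
        (fun h => absurd (h ▸ hY) (h₀ Y)) (fun _ => rfl)
      exact ⟨c, hc, h₁, h₂, fun X Y h' => by rw [hZ X Y h', h₃]⟩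
  · obtain ⟨l, G, hl, hl', hjl, hG⟩ := exists_isSplitting hT hk hF j
    obtain ⟨a, ha, ha'⟩ : ∃ a, (∀ y, ¬g (cond a s t) y) ∧ (j = 1 → a = true) := by
      by_cases hj : j = 1
      -- The copy of `s` on the ascending edge with label 1 is the vertex 0, so `s` in the domain of
      -- `g` would contradict `h₀`.
      · refine ⟨true, fun y hy => ?_, fun _ => rfl⟩
        refine h₀ _ ⟨.up (j := 1) le_rfl (by omega), hj.symm, s, y, hy, ?_, rfl⟩
        rw [embed_source hT.ne, LadderEdge.vertex_up]
        rfl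
      · obtain ⟨a, ha⟩ := exists_end_notMem_dom hT hg
        exact ⟨a, ha, fun h => absurd h hj⟩
    obtain ⟨b, hb, b0, b1, hbj⟩ := exists_balanced_source hn hl hl' hjl a ha'
    obtain ⟨c, hc, hc', hcg, -⟩ := exists_compatible_dom hT hG hg ha hb hbj s
    exact ⟨c, hc, by rw [hc', b0], by rw [hc', b1], hcg⟩

theorem spread_sep_target (hT : IsFrame k s t T) (hn : 3 ≤ n) (hk : k + 2 ≤ n)
    {F : ℕ → BinRel (LadderPoint n s t)} (hF : IsFamily k (spreadSet n s t T) F)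
    {f : BinRel (LadderPoint n s t)} (hf : f ∈ spreadSet n s t T)
    (h₀ : ∀ Y, ¬f (.base (2 * n)) Y) :
    ∃ c, (∀ i, IsCompatible c (F i)) ∧ c (.base 0) = false ∧ c (.base (2 * n)) = true ∧
      ∀ X Y, f X Y → c X = false := by
  rcases hf with hf | ⟨j, g, hg, rfl⟩
  · rcases hf.dom_subsingleton with h | ⟨Z, ⟨Y, hY⟩, hZ⟩
    · obtain ⟨c, hc, h₁, h₂, -⟩ := spread_sep_ends hT hn hk hF (.base 0) false true false
        (fun _ => rfl) (fun h => by have := LadderPoint.base.inj h; omega)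
      exact ⟨c, hc, h₁, h₂, fun X Y h' => absurd h' (h X Y)⟩
    · obtain ⟨c, hc, h₁, h₂, h₃⟩ := spread_sep_ends hT hn hk hF Z false true false
        (fun _ => rfl) (fun h => absurd (h ▸ hY) (h₀ Y))
      exact ⟨c, hc, h₁, h₂, fun X Y h' => by rw [hZ X Y h', h₃]⟩
  · obtain ⟨l, G, hl, hl', hjl, hG⟩ := exists_isSplitting hT hk hF j
    obtain ⟨a, ha, ha', ha''⟩ : ∃ a, (∀ y, ¬g (cond a s t) y) ∧ (j = n → a = true) ∧
        (j = 2 * n → a = false) := by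
      by_cases hj : j = n
      · refine ⟨true, fun y hy => ?_, fun _ => rfl, by omega⟩
        refine h₀ _ ⟨.down (j := n) (by omega) le_rfl, hj.symm, s, y, hy, ?_, rfl⟩
        rw [embed_source hT.ne, LadderEdge.vertex_down, cond_false, mirror, if_neg (by omega),
          if_pos rfl]
      by_cases hj' : j = 2 * n
      · refine ⟨false, fun y hy => ?_, by omega, fun _ => rfl⟩
        refine h₀ _ ⟨.up (j := 2 * n) (by omega) le_rfl, hj'.symm, t, y, hy, ?_, rfl⟩
        rw [embed_target hT.ne, LadderEdge.vertex_up]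
        rfl
      · obtain ⟨a, ha⟩ := exists_end_notMem_dom hT hg
        exact ⟨a, ha, fun h => absurd h hj, fun h => absurd h hj'⟩
    obtain ⟨b, hb, b0, b1, hbj⟩ := exists_balanced_target hn hl hl' hjl a ha' ha''
    obtain ⟨c, hc, hc', hcg, -⟩ := exists_compatible_dom hT hG hg ha hb hbj s
    exact ⟨c, hc, by rw [hc', b0], by rw [hc', b1], hcg⟩

theorem spread_sep_dom (hT : IsFrame k s t T) (hn : 3 ≤ n) (hk : k + 2 ≤ n)
    {F : ℕ → BinRel (LadderPoint n s t)} (hF : IsFamily k (spreadSet n s t T) F)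
    {f : BinRel (LadderPoint n s t)} (hf : f ∈ spreadSet n s t T)
    {X : LadderPoint n s t} (hX : ∀ Y, ¬f X Y) :
    ∃ c, (∀ i, IsCompatible c (F i)) ∧ c X = true ∧ ∀ X' Y', f X' Y' → c X' = false := by
  rcases hf with hf | ⟨j, g, hg, rfl⟩
  · rcases hf.dom_subsingleton with h | ⟨Z, ⟨Y, hY⟩, hZ⟩
    · exact ⟨fun _ => true, fun _ => isCompatible_const _ _, rfl, fun X Y h' => absurd h' (h X Y)⟩
    · obtain ⟨c, hc, hne⟩ := spread_sep hT hn hk hF (X := X) (Y := Z) fun h => hX Y (h ▸ hY)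
      cases hcX : c X
      · refine ⟨fun x => !c x, fun i => (hc i).not, by simp [hcX], fun X' Y' h' => ?_⟩
        rw [hZ X' Y' h']
        simpa [hcX] using hne.symm
      · refine ⟨c, hc, hcX, fun X' Y' h' => ?_⟩
        rw [hZ X' Y' h']
        simpa [hcX] using hne.symm
  · obtain ⟨l, G, hl, hl', hjl, hG⟩ := exists_isSplitting hT hk hF j
    -- On a copy with label `j`, a separating colouring of `V` is repeated on all copies of that
    -- label. Off these copies, it suffices to colour a vertex `true` that avoids label `j`: the
    -- point itself or a suitable end of its edge.
    by_cases hon : ∃ e : LadderEdge n, e.label = j ∧ ∃ x, X = embed s t e x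
    · obtain ⟨e, he, x, rfl⟩ := hon
      obtain ⟨C, hC, hCx, hCg⟩ := hT.sep_dom (hG.1 j) hg (x := x)
        fun y hy => hX _ (spread_apply he hy)
      obtain ⟨b, hb, hbe⟩ := exists_balanced_hasEnds hn hl hl' hjl (C s) (C t)
      obtain ⟨c, hc, -, hx, -⟩ := exists_compatible hT hG hb j C hC hbe (fun _ => x)
        (fun _ => true)
      refine ⟨c, hc, by rw [hx e he, hCx], ?_⟩
      rintro _ _ ⟨e', he', x', y', hxy, rfl, rfl⟩
      rw [hx e' he']
      exact hCg x' y' hxy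
    · obtain ⟨a, ha⟩ := exists_end_notMem_dom hT hg
      rcases X.cases with ⟨w, rfl⟩ | ⟨e, x, hs, ht, rfl⟩
      · obtain ⟨b, hb, bw, hbj⟩ := exists_balanced_avoid hn hl hl' hjl (w := w) a fun e he p hp =>
          hon ⟨e, he, cond p t s, by rw [embed_end hT.ne, hp]⟩
        obtain ⟨c, hc, hc', hcg, -⟩ := exists_compatible_dom hT hG hg ha hb hbj s
        exact ⟨c, hc, by rw [hc', bw], hcg⟩
      · have hej : e.label ≠ j := fun he => hon ⟨e, he, x, rfl⟩
        obtain ⟨p, hp⟩ := e.exists_vertex_notMem hn hej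
        obtain ⟨b, hb, bw, hbj⟩ := exists_balanced_avoid hn hl hl' hjl a hp
        obtain ⟨c, hc, hc', hcg, hx⟩ := exists_compatible_dom hT hG hg ha hb hbj x
        exact ⟨c, hc, hx e hej hs ht p bw, hcg⟩

end Ladder

/-- Replacing the edges of the ladder graph by copies of a frame gives a frame. -/
theorem IsFrame.spread {V : Type v} {n k : ℕ} {s t : V} {T : Set (BinRel V)}
    (hT : IsFrame k s t T) (hn : 3 ≤ n) (hk : k + 2 ≤ n) :
    IsFrame k (LadderPoint.base 0) (LadderPoint.base (2 * n)) (spreadSet n s t T) where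
  ne h := by have := LadderPoint.base.inj h; omega
  slim_mem hf := Or.inl hf
  mul_mem := mul_mem_spreadSet hT hn
  converse_mem := converse_mem_spreadSet hT
  unique hf := spread_unique hT hn hf
  ends hf := spread_ends hT hn hf
  sep_dom hF _ hf _ hX := spread_sep_dom hT hn hk hF hf hX
  sep hF _ _ h := spread_sep hT hn hk hF h
  sep_ends hF := spread_sep_ends hT hn hk hF
  sep_source hF _ hf := spread_sep_source hT hn hk hF hf
  sep_target hF _ hf := spread_sep_target hT hn hk hF hf

/-! ### Transfer of identities from the Brandt monoid -/

instance {V : Type v} : Star (BinRel V) := ⟨BinRel.converse⟩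

/-- A strict upper bound for the indices of the variables of a term. -/
def Term.bound : Term → ℕ
  | .var i => i + 1
  | .mul p q => max p.bound q.bound
  | .star p => p.bound

theorem Term.eval_congr {A : Type u} [Mul A] [Star A] {θ θ' : ℕ → A} (p : Term)
    (h : ∀ i < p.bound, θ i = θ' i) : p.eval θ = p.eval θ' := by
  induction p with
  | var i => exact h i (Nat.lt_succ_self i)
  | mul p q hp hq =>
    simp only [Term.eval]
    rw [hp fun i hi => h i (lt_max_of_lt_left hi), hq fun i hi => h i (lt_max_of_lt_right hi)]
  | star p hp =>
    simp only [Term.eval]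
    rw [hp h]

theorem Term.map_eval {A : Type u} [Mul A] [Star A] {A' : Type v} [Mul A'] [Star A'] (ψ : A → A')
    (hmul : ∀ a b, ψ (a * b) = ψ a * ψ b) (hstar : ∀ a, ψ (Star.star a) = Star.star (ψ a))
    (θ : ℕ → A) (p : Term) : ψ (p.eval θ) = p.eval fun i => ψ (θ i) := by
  induction p with
  | var i => rfl
  | mul p q hp hq => simp only [Term.eval, hmul, hp, hq]
  | star p hp => simp only [Term.eval, hstar, hp]

/-! ### Brandt matrices as relations on two points -/

/-- The nonzero entries of a matrix in the Brandt monoid. -/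
def brandtRel (M : Brandt) : BinRel (Fin 2) := fun i j => M.1 i j ≠ 0

theorem brandtSet_nonneg {M : Matrix (Fin 2) (Fin 2) ℤ} (hM : M ∈ brandtSet) : ∀ i j, 0 ≤ M i j := by
  simp only [brandtSet, Set.mem_insert_iff, Set.mem_singleton_iff] at hM
  intro i j
  rcases hM with rfl | rfl | rfl | rfl | rfl | rfl <;> fin_cases i <;> fin_cases j <;> simp

theorem brandtSet_unique {M : Matrix (Fin 2) (Fin 2) ℤ} (hM : M ∈ brandtSet) :
    ∀ i j j', M i j ≠ 0 → M i j' ≠ 0 → j = j' := by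
  simp only [brandtSet, Set.mem_insert_iff, Set.mem_singleton_iff] at hM
  intro i j j'
  rcases hM with rfl | rfl | rfl | rfl | rfl | rfl <;> fin_cases i <;> fin_cases j <;>
    fin_cases j' <;> simp

/-- Entries are nonnegative, so no cancellation occurs in a matrix product. -/
theorem brandtRel_mul (M N : Brandt) : brandtRel (M * N) = brandtRel M * brandtRel N := by
  refine BinRel.ext fun i j => ?_
  change (M.1 * N.1) i j ≠ 0 ↔ ∃ l, M.1 i l ≠ 0 ∧ N.1 l j ≠ 0
  rw [Matrix.mul_apply, ne_eq, Finset.sum_eq_zero_iff_of_nonneg fun l _ =>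
    mul_nonneg (brandtSet_nonneg M.2 i l) (brandtSet_nonneg N.2 l j)]
  simp only [Finset.mem_univ, mul_eq_zero, true_imp_iff, not_forall, not_or]

theorem brandtRel_star (M : Brandt) : brandtRel (Star.star M) = Star.star (brandtRel M) := rfl

theorem brandtRel_unique (M : Brandt) {i j j' : Fin 2} (h : brandtRel M i j) (h' : brandtRel M i j') :
    j = j' :=
  brandtSet_unique M.2 i j j' h h'

theorem brandtRel_unique_left (M : Brandt) {i i' j : Fin 2} (h : brandtRel M i j)
    (h' : brandtRel M i' j) : i = i' :=
  brandtRel_unique (Star.star M) (j := i) (j' := i') h h'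

theorem exists_brandtRel_empty : ∃ M : Brandt, ∀ i j, ¬brandtRel M i j :=
  ⟨⟨!![0, 0; 0, 0], by simp [Brandt, brandtSet]⟩, by
    intro i; fin_cases i <;> simp [brandtRel]⟩

theorem exists_brandtRel_eq : ∃ M : Brandt, ∀ i, brandtRel M i i :=
  ⟨⟨!![1, 0; 0, 1], by simp [Brandt, brandtSet]⟩, by
    intro i; fin_cases i <;> simp [brandtRel]⟩

theorem exists_brandtRel_single (a a' : Fin 2) :
    ∃ M : Brandt, ∀ i j, brandtRel M i j ↔ i = a ∧ j = a' := by
  fin_cases a <;> fin_cases a'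
  · exact ⟨⟨!![1, 0; 0, 0], by simp [Brandt, brandtSet]⟩, by
    intro i; fin_cases i <;> simp [brandtRel]⟩
  · exact ⟨⟨!![0, 1; 0, 0], by simp [Brandt, brandtSet]⟩, by
    intro i; fin_cases i <;> simp [brandtRel]⟩
  · exact ⟨⟨!![0, 0; 1, 0], by simp [Brandt, brandtSet]⟩, by
    intro i; fin_cases i <;> simp [brandtRel]⟩
  · exact ⟨⟨!![0, 0; 0, 1], by simp [Brandt, brandtSet]⟩, by
    intro i; fin_cases i <;> simp [brandtRel]⟩

/-- The colour `a` as an index of a row or column. -/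
def colorIndex (a : Bool) : Fin 2 := cond a 1 0

theorem colorIndex_injective : Function.Injective colorIndex := by
  intro a b; cases a <;> cases b <;> simp [colorIndex]

section Transfer

variable {V : Type v} {k : ℕ} {s t : V} {T : Set (BinRel V)} {F : ℕ → BinRel V}

/-- The matrices `M` simulate the relations `F` after identification of points of equal colour. -/
def Simulates (c : V → Bool) (M : ℕ → Brandt) (F : ℕ → BinRel V) : Prop :=
  ∀ i x y, F i x y → brandtRel (M i) (colorIndex (c x)) (colorIndex (c y))

/-- The two kinds of compatibility correspond to the identity matrix and the matrix units. The
additional clauses keep the simulation tight enough to detect that a point is outside a domain or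
range. -/
theorem exists_simulates {c : V → Bool} (hc : ∀ i, IsCompatible c (F i)) :
    ∃ M, Simulates c M F ∧
      (∀ i, (∀ x y, F i x y → c x = false) → ∀ j, ¬brandtRel (M i) (colorIndex true) j) ∧
      ∀ i, (∀ x y, F i x y → c y = false) → ∀ j, ¬brandtRel (M i) j (colorIndex true) := by
  have h : ∀ i, ∃ M : Brandt,
      (∀ x y, F i x y → brandtRel M (colorIndex (c x)) (colorIndex (c y))) ∧
      ((∀ x y, F i x y → c x = false) → ∀ j, ¬brandtRel M (colorIndex true) j) ∧
      ((∀ x y, F i x y → c y = false) → ∀ j, ¬brandtRel M j (colorIndex true)) := by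
    intro i
    by_cases hne : ∃ x y, F i x y
    swap
    · push Not at hne
      obtain ⟨M, hM⟩ := exists_brandtRel_empty
      exact ⟨M, fun x y h => absurd h (hne x y), fun _ j => hM _ j, fun _ j => hM j _⟩
    obtain ⟨x₀, y₀, h₀⟩ := hne
    have single : ∀ a a', (∀ x y, F i x y → c x = a ∧ c y = a') → ∃ M : Brandt,
        (∀ x y, F i x y → brandtRel M (colorIndex (c x)) (colorIndex (c y))) ∧
        ((∀ x y, F i x y → c x = false) → ∀ j, ¬brandtRel M (colorIndex true) j) ∧
        ((∀ x y, F i x y → c y = false) → ∀ j, ¬brandtRel M j (colorIndex true)) := by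
      intro a a' h
      obtain ⟨M, hM⟩ := exists_brandtRel_single (colorIndex a) (colorIndex a')
      refine ⟨M, fun x y hxy => ?_, fun h' j hj => ?_, fun h' j hj => ?_⟩
      · rw [hM, (h x y hxy).1, (h x y hxy).2]
        exact ⟨rfl, rfl⟩
      · have h₁ := colorIndex_injective ((hM _ _).1 hj).1
        rw [← (h _ _ h₀).1, h' _ _ h₀] at h₁
        cases h₁
      · have h₁ := colorIndex_injective ((hM _ _).1 hj).2
        rw [← (h _ _ h₀).2, h' _ _ h₀] at h₁
        cases h₁
    rcases hc i with h | ⟨a, a', h⟩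
    -- The identity matrix would have a nonzero row for `true`; if only the colour `false` occurs, a
    -- matrix unit avoids this.
    · by_cases hd : ∀ x y, F i x y → c x = false
      · exact single false false fun x y hxy => ⟨hd x y hxy, h x y hxy ▸ hd x y hxy⟩
      · obtain ⟨M, hM⟩ := exists_brandtRel_eq
        refine ⟨M, fun x y hxy => h x y hxy ▸ hM _, fun h' => absurd h' hd, fun h' => ?_⟩
        exact absurd (fun x y hxy => (h x y hxy).trans (h' x y hxy)) hd
    · exact single a a' h
  choose M h₁ h₂ h₃ using h
  exact ⟨M, h₁, h₂, h₃⟩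

theorem Simulates.eval {c : V → Bool} {M : ℕ → Brandt} (h : Simulates c M F) (p : Term) :
    ∀ x y, p.eval F x y → brandtRel (p.eval M) (colorIndex (c x)) (colorIndex (c y)) := by
  induction p with
  | var i => exact h i
  | mul p q hp hq =>
    rintro x z ⟨y, h₁, h₂⟩
    simp only [Term.eval, brandtRel_mul]
    exact ⟨_, hp x y h₁, hq y z h₂⟩
  | star p hp =>
    intro x y hxy
    simp only [Term.eval, brandtRel_star]
    exact hp y x hxy

/-- A point lies in the domain (range) of the value of a term if this holds in all simulations. -/
theorem IsFrame.exists_eval (hT : IsFrame k s t T) (hF : IsFamily k T F) (p : Term) :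
    (∀ x, (∀ c M, Simulates c M F → ∃ j, brandtRel (p.eval M) (colorIndex (c x)) j) →
      ∃ y, p.eval F x y) ∧
    ∀ y, (∀ c M, Simulates c M F → ∃ j, brandtRel (p.eval M) j (colorIndex (c y))) →
      ∃ x, p.eval F x y := by
  induction p with
  | var i =>
    constructor
    · intro x hx
      by_contra! hcon
      obtain ⟨c, hc, hcx, hcf⟩ := hT.sep_dom hF (hF.1 i) hcon
      obtain ⟨M, hM, hd, -⟩ := exists_simulates hc
      obtain ⟨j, hj⟩ := hx c M hM
      exact hd i hcf j (hcx ▸ hj)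
    · intro y hy
      by_contra! hcon
      obtain ⟨c, hc, hcx, hcf⟩ := hT.sep_dom hF (hT.converse_mem (hF.1 i)) (x := y) hcon
      obtain ⟨M, hM, -, hd⟩ := exists_simulates hc
      obtain ⟨j, hj⟩ := hy c M hM
      exact hd i (fun x' y' h => hcf y' x' h) j (hcx ▸ hj)
  | mul p q hp hq =>
    simp only [Term.eval, brandtRel_mul]
    constructor
    · intro x hx
      obtain ⟨y, hy⟩ := hp.1 x fun c M hM => by
        obtain ⟨j, m, h₁, h₂⟩ := hx c M hM
        exact ⟨m, h₁⟩
      obtain ⟨z, hz⟩ := hq.1 y fun c M hM => by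
        obtain ⟨j, m, h₁, h₂⟩ := hx c M hM
        -- A row of a Brandt matrix has at most one nonzero entry, so the intermediate index is
        -- forced to be the colour of `y`.
        obtain rfl := brandtRel_unique _ h₁ (hM.eval p x y hy)
        exact ⟨j, h₂⟩
      exact ⟨z, y, hy, hz⟩
    · intro z hz
      obtain ⟨y, hy⟩ := hq.2 z fun c M hM => by
        obtain ⟨j, m, h₁, h₂⟩ := hz c M hM
        exact ⟨m, h₂⟩
      obtain ⟨x, hx⟩ := hp.2 y fun c M hM => by
        obtain ⟨j, m, h₁, h₂⟩ := hz c M hM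
        obtain rfl := brandtRel_unique_left _ h₂ (hM.eval q y z hy)
        exact ⟨j, h₁⟩
      exact ⟨x, y, hx, hy⟩
  | star p hp =>
    simp only [Term.eval, brandtRel_star]
    -- The involution exchanges domain and range, which is why both are treated in one induction.
    exact ⟨fun x hx => hp.2 x hx, fun y hy => hp.1 y hy⟩

/-- Every simulation places the colour of `x` in the domain of `q`, so `q` relates `x` to some point
`z`. In every simulation `z` and `y` have the same colour because rows have one nonzero entry, and
separation of points yields `z = y`. -/
theorem IsFrame.eval_imp (hT : IsFrame k s t T) (hF : IsFamily k T F) {p q : Term}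
    (h : Satisfies Brandt ⟨p, q⟩) {x y : V} (hxy : p.eval F x y) : q.eval F x y := by
  have h' : ∀ c M, Simulates c M F → brandtRel (q.eval M) (colorIndex (c x)) (colorIndex (c y)) :=
    fun c M hM => by
      have := hM.eval p x y hxy
      rwa [show p.eval M = q.eval M from h M] at this
  obtain ⟨z, hz⟩ := (hT.exists_eval hF q).1 x fun c M hM => ⟨_, h' c M hM⟩
  suffices z = y by rwa [← this]
  by_contra hne
  obtain ⟨c, hc, hcne⟩ := hT.sep hF hne
  obtain ⟨M, hM, -⟩ := exists_simulates hc
  exact hcne (colorIndex_injective (brandtRel_unique _ (hM.eval q x z hz) (h' c M hM)))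

/-- The involution semigroup formed by the members of a frame. -/
def FrameAlgebra (_hT : IsFrame k s t T) : Type v := T

instance (hT : IsFrame k s t T) : Mul (FrameAlgebra hT) :=
  ⟨fun f g => ⟨f.1 * g.1, hT.mul_mem f.2 g.2⟩⟩

instance (hT : IsFrame k s t T) : Star (FrameAlgebra hT) :=
  ⟨fun f => ⟨f.1.converse, hT.converse_mem f.2⟩⟩

/-- The members of a frame satisfy all identities of the Brandt monoid in `k` variables. -/
theorem IsFrame.satisfies (hT : IsFrame k s t T) {e : Identity} (he : Satisfies Brandt e)
    (hl : e.lhs.bound ≤ k) (hr : e.rhs.bound ≤ k) : Satisfies (FrameAlgebra hT) e := by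
  intro θ
  let F (i : ℕ) : BinRel V := if i < k then (θ i).1 else BinRel.empty
  have hF : IsFamily k T F := by
    refine ⟨fun i => ?_, fun i hi x y => ?_⟩
    · by_cases h : i < k
      · simpa only [F, if_pos h] using (θ i).2
      · simpa only [F, if_neg h] using hT.slim_mem isSlim_empty
    · have h : F i = BinRel.empty := if_neg (not_lt.mpr hi)
      exact (congrFun (congrFun h x) y).mp
  have eval_eq : ∀ p : Term, p.bound ≤ k → (p.eval θ).1 = p.eval F := by
    intro p hp
    rw [Term.map_eval (A' := BinRel V) (fun f : FrameAlgebra hT => f.1) (fun _ _ => rfl)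
      (fun _ => rfl)]
    exact p.eval_congr fun i hi => (if_pos (hi.trans_le hp)).symm
  apply Subtype.ext
  rw [eval_eq _ hl, eval_eq _ hr]
  exact BinRel.ext fun x y =>
    ⟨fun h => hT.eval_imp hF he h, fun h => hT.eval_imp hF (fun θ => (he θ).symm) h⟩

end Transfer

/-! ### The words `v_{n,m}^{(h)}` in a frame -/

section Path

variable {W : Type v}

theorem prod_range'_apply {f : ℕ → BinRel W} {P : ℕ → W} (a len : ℕ)
    (h : ∀ i, a ≤ i → i < a + len → f i (P i) (P (i + 1))) :
    ((List.range' a len).map f).prod (P a) (P (a + len)) := by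
  induction len generalizing a with
  | zero => simp [BinRel.one_apply]
  | succ len ih =>
    rw [List.range'_succ, List.map_cons, List.prod_cons]
    refine ⟨_, h a le_rfl (by omega), ?_⟩
    have := ih (a + 1) fun i hi hi' => h i (by omega) (by omega)
    rwa [show a + 1 + len = a + (len + 1) by omega] at this

theorem prod_reverse_range'_apply {f : ℕ → BinRel W} {P : ℕ → W} (a len : ℕ)
    (h : ∀ i, a ≤ i → i < a + len → f i (P (i + 1)) (P i)) :
    ((List.range' a len).reverse.map f).prod (P (a + len)) (P a) := by
  induction len generalizing a with
  | zero => simp [BinRel.one_apply]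
  | succ len ih =>
    rw [List.range'_succ, List.reverse_cons, List.map_append, List.prod_append]
    have := ih (a + 1) fun i hi hi' => h i (by omega) (by omega)
    rw [show a + 1 + len = a + (len + 1) by omega] at this
    exact ⟨_, this, by simpa using h a le_rfl (by omega)⟩

theorem BinRel.pow_apply {f : BinRel W} {x : W} (h : f x x) (m : ℕ) : (f ^ m) x x := by
  induction m with
  | zero => exact BinRel.one_apply.2 rfl
  | succ m ih => exact (pow_succ f m).symm ▸ (⟨x, ih, h⟩ : (f ^ m * f) x x)

variable {V : Type v} {n : ℕ} {s t : V}

/-- The first factor climbs from 0 to 2n. The repeated factor is a closed walk at 2n, down to n by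
the mirror chain and up again, so its exponent does not matter. -/
theorem vPattern_apply (hn : 3 ≤ n) (m : ℕ) {f : ℕ → BinRel (LadderPoint n s t)}
    (hf : ∀ e : LadderEdge n, f e.label (.base (e.vertex false)) (.base (e.vertex true))) :
    vPattern n m f (.base 0) (.base (2 * n)) := by
  have up : ∀ i, 1 ≤ i → i ≤ 2 * n → f i (.base (i - 1)) (.base i) := fun i h h' => by
    simpa [LadderEdge.vertex_up, LadderEdge.label_up] using hf (.up h h')
  have down : ∀ i, 1 ≤ i → i ≤ n → f i (.base (mirror n i)) (.base (mirror n (i - 1))) :=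
    fun i h h' => by
      simpa [LadderEdge.vertex_down, LadderEdge.label_down] using hf (.down h h')
  have h₁ := prod_range'_apply (f := f) (P := fun i => .base (i - 1)) 1 (2 * n)
    fun i hi hi' => up i hi (by omega)
  have h₂ := prod_reverse_range'_apply (f := f) (P := fun i => .base (mirror n (i - 1))) 1 n
    fun i hi hi' => down i hi (by omega)
  have h₃ := prod_range'_apply (f := f) (P := fun i => .base (i - 1)) (n + 1) n
    fun i hi hi' => up i (by omega) (by omega)
  have e₁ : 1 + n - 1 = n := by omega
  have e₂ : n + 1 + n - 1 = 2 * n := by omega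
  have e₃ : mirror n n = 2 * n := by rw [mirror, if_neg (by omega), if_pos rfl]
  have e₄ : mirror n 0 = n := if_pos rfl
  have e₅ : 1 + 2 * n - 1 = 2 * n := by omega
  simp only [e₁, e₂, e₃, e₄, e₅, Nat.sub_self, Nat.add_sub_cancel] at h₁ h₂ h₃
  exact ⟨_, h₁, BinRel.pow_apply ⟨_, h₂, h₃⟩ _⟩

theorem lift_spread_apply {φ : List ℕ → BinRel V} {j : ℕ} {e : LadderEdge n} (he : e.label = j)
    (w : Word) : ∀ {x y}, FreeMonoid.lift φ w x y →
      FreeMonoid.lift (fun I => spread n s t j (φ I)) w (embed s t e x) (embed s t e y) := by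
  induction w using FreeMonoid.inductionOn' with
  | one =>
    intro x y h
    rw [map_one] at h ⊢
    rw [BinRel.one_apply.1 h]
    exact BinRel.one_apply.2 rfl
  | of_mul I w ih =>
    intro x y h
    rw [map_mul, FreeMonoid.lift_eval_of] at h ⊢
    obtain ⟨z, h₁, h₂⟩ := h
    exact ⟨_, spread_apply he h₁, ih h₂⟩

theorem map_vPattern {M : Type u} {N : Type v} [Monoid M] [Monoid N] (ψ : M →* N) (n m : ℕ)
    (f : ℕ → M) : ψ (vPattern n m f) = vPattern n m fun j => ψ (f j) := by
  simp [vPattern, map_list_prod, List.map_map, Function.comp_def]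

/-- For every height there is a frame in which the value of the word `v_{n,m}^{(h)}` relates the two
ends. -/
theorem exists_frame (k m : ℕ) (hn : 3 ≤ n) (hk : k + 2 ≤ n) (h : ℕ) :
    ∃ (V : Type v) (s t : V) (T : Set (BinRel V)), IsFrame k s t T ∧
      ∃ φ : List ℕ → BinRel V, (∀ I, φ I ∈ T) ∧ FreeMonoid.lift φ (vWord n m h) s t := by
  induction h with
  | zero =>
    refine ⟨ULift Bool, ⟨false⟩, ⟨true⟩, _, isFrame_two k (by simp) ?_,
      fun _ x y => x = ⟨false⟩ ∧ y = ⟨true⟩, ?_, ?_⟩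
    · rintro ⟨_ | _⟩ <;> simp
    · rintro I x y x' y' ⟨rfl, rfl⟩ ⟨rfl, rfl⟩
      exact ⟨rfl, rfl⟩
    · exact ⟨rfl, rfl⟩
  | succ h ih =>
    obtain ⟨V, s, t, T, hT, φ, hφ, hst⟩ := ih
    refine ⟨_, _, _, _, hT.spread hn hk,
      -- The last number of an index is the one added at this level and selects the label; the rest
      -- is interpreted as before. The default 0 arises only for the empty index, which does not
      -- occur after `appendIndex`.
      fun I => spread n s t (I.getLast?.getD 0) (φ I.dropLast), fun I => ?_, ?_⟩
    · exact Or.inr ⟨_, _, hφ _, rfl⟩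
    · rw [vWord, map_vPattern]
      refine vPattern_apply hn m fun e => ?_
      have key := lift_spread_apply (s := s) (t := t) (e := e) rfl _ hst
      rw [embed_source hT.ne, embed_target hT.ne] at key
      have append : ∀ j, (FreeMonoid.lift fun I : List ℕ =>
          spread n s t (I.getLast?.getD 0) (φ I.dropLast)).comp (appendIndex j) =
            FreeMonoid.lift fun I => spread n s t j (φ I) :=
        fun j => FreeMonoid.hom_eq fun I => by simp [appendIndex]
      rw [← append] at key
      exact key

end Path

/-! ### Words as terms -/

/-- A nonempty word as a term. -/
def wordTerm : List (List ℕ) → Term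
  | [] => .var 0
  | [I] => .var (Encodable.encode I)
  | I :: J :: w => .mul (.var (Encodable.encode I)) (wordTerm (J :: w))

theorem map_eval_wordTerm {A : Type u} [Mul A] [Star A] {N : Type v} [Monoid N] (ψ : A → N)
    (hψ : ∀ a b, ψ (a * b) = ψ a * ψ b) (θ : ℕ → A) (w : Word) (hw : w ≠ 1) :
    ψ ((wordTerm w.toList).eval θ) =
      FreeMonoid.lift (fun I => ψ (θ (Encodable.encode I))) w := by
  have key : ∀ (l : List (List ℕ)), l ≠ [] → ψ ((wordTerm l).eval θ) =
      (l.map fun I => ψ (θ (Encodable.encode I))).prod := by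
    intro l hl
    induction l with
    | nil => exact absurd rfl hl
    | cons I l ih =>
      cases l with
      | nil => simp [wordTerm, Term.eval]
      | cons J l =>
        rw [wordTerm, Term.eval, hψ, ih (by simp), List.map_cons, List.prod_cons]
        rfl
  rw [FreeMonoid.lift_apply]
  exact key _ fun h => hw (FreeMonoid.toList.injective h)

end InvSemigroup

theorem mainTheorem6 (S : Type u) [Semigroup S] [StarMul S] (q r : ℕ)
    (hq : 1 ≤ q) (hr : 1 ≤ r)
    (hv : ∀ n : ℕ, 2 ≤ n →
      InvSemigroup.SatisfiesWords S (InvSemigroup.vWord n q r) (InvSemigroup.vWord n q r ^ 2))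
    (hB : ∀ e : InvSemigroup.Identity,
      InvSemigroup.Satisfies S e → InvSemigroup.Satisfies InvSemigroup.Brandt e) :
    ¬ InvSemigroup.HasFiniteIdentityBasis.{u, v} S := by
  open InvSemigroup in
  rintro ⟨B, hfin, hBS, hbasis⟩
  obtain ⟨k, hk⟩ := (hfin.image fun e : Identity => max e.lhs.bound e.rhs.bound).bddAbove
  have hk' : ∀ e ∈ B, e.lhs.bound ≤ k ∧ e.rhs.bound ≤ k := fun e he =>
    max_le_iff.1 (hk (Set.mem_image_of_mem _ he))
  -- The value `k + 3` ensures both 3 ≤ n and k + 2 ≤ n.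
  obtain ⟨V, s, t, T, hT, φ, hφ, hst⟩ :=
    exists_frame.{v} (n := k + 3) k q (by omega) (by omega) r
  set w := vWord (k + 3) q r with hw
  have hw1 : w ≠ 1 := fun h => by
    rw [h, map_one] at hst
    exact hT.ne hst
  have hw2 : w ^ 2 ≠ 1 := fun h => by
    rw [pow_two] at h
    have := congrArg FreeMonoid.length h
    rw [FreeMonoid.length_mul, FreeMonoid.length_one] at this
    exact hw1 (FreeMonoid.length_eq_zero.1 (by omega))
  have hS : Satisfies S ⟨wordTerm w.toList, wordTerm (w ^ 2).toList⟩ := fun θ => by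
    have hmul : ∀ a b : S, ((a * b : S) : WithOne S) = a * b := fun a b => WithOne.coe_mul a b
    apply WithOne.coe_injective
    rw [map_eval_wordTerm _ hmul θ w hw1, map_eval_wordTerm _ hmul θ _ hw2]
    exact hv (k + 3) (by omega) fun I => θ (Encodable.encode I)
  have hA := hbasis _ hS (FrameAlgebra hT) fun b hb =>
    hT.satisfies (hB b (hBS b hb)) (hk' b hb).1 (hk' b hb).2
  let θ (i : ℕ) : FrameAlgebra hT := ⟨φ ((Encodable.decode i).getD []), hφ _⟩
  have hθ : (fun I => (θ (Encodable.encode I)).1) = φ := by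
    funext I
    simp [θ]
  have hmul : ∀ f g : FrameAlgebra hT, (f * g).1 = f.1 * g.1 := fun _ _ => rfl
  have h₁ := map_eval_wordTerm (N := BinRel V) (fun f : FrameAlgebra hT => f.1) hmul θ w hw1
  have h₂ := map_eval_wordTerm (N := BinRel V) (fun f : FrameAlgebra hT => f.1) hmul θ _ hw2
  rw [hθ] at h₁ h₂
  have hmem : FreeMonoid.lift φ w ∈ T := h₁ ▸ Subtype.property _
  have hsq : FreeMonoid.lift φ w = FreeMonoid.lift φ w * FreeMonoid.lift φ w := by
    rw [← map_mul, ← pow_two, ← h₂, ← h₁]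
    exact congrArg Subtype.val (hA θ)
  -- Idempotency would factor the pair (`s`, `t`) through some `y`; uniqueness of images gives `y =
  -- t`, so `t` would join `s` in the domain.
  obtain ⟨y, hy, hy'⟩ := (congrFun (congrFun hsq s) t).mp hst
  obtain rfl := hT.unique hmem hy hst
  exact hT.ends hmem hst hy'
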